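/- Let $V=\{1,\dots,N\}$, $N\ge 2$, be the players of a game and let $G_I$ be a connected undirected (simple) graph on $V$, the interference graph. Write $N_I(i)$ for the set of neighbours of $i$ in $G_I$ and $\tilde N_I(i)=N_I(i)\cup\{i\}$. Player $i$ has an action set $\Omega_i\subset\mathbb R$ and a cost $J_i:\Omega^i\to\mathbb R$, where $\Omega^i=\prod_{j\in\tilde N_I(i)}\Omega_j$; a point of $\Omega^i$ is written $(x_i,u)$ with $x_i\in\Omega_i$ and $u\in\Omega^i_{-i}=\prod_{j\in N_I(i)}\Omega_j$. Let $\Omega=\prod_{i\in V}\Omega_i$, and for $x\in\Omega$ let $x^i=(x_i,x^i_{-i})\in\Omega^i$ be the restriction of $x$ to $\tilde N_I(i)$. A Nash equilibrium is a point $x^*\in\Omega$ with $J_i(x_i^*,x_{-i}^{i\,*})\le J_i(x_i,x_{-i}^{i\,*})$ for all $i\in V$ and all $x_i\in\Omega_i$. Assume the following. 1. A maximal triangle-free spanning subgraph of $G_I$ is a triangle-free spanning subgraph of $G_I$ to which no missing edge of $G_I$ can be added without creating a triangle. The communication graph $G_C$ satisfies $G_m\subseteq G_C\subseteq G_I$ for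 some maximal triangle-free spanning subgraph $G_m$ of $G_I$ if there is one, and $G_C=G_I$ otherwise. 2. Every $\Omega_i$ is non-empty, compact and convex; $J_i$ is jointly continuous on $\Omega^i$, and for every fixed $u\in\Omega^i_{-i}$ it is continuously differentiable and convex in $x_i\in\Omega_i$ (derivatives at end points of $\Omega_i$ are one-sided). 3. The pseudo-gradient $F(x)=[\nabla_{x_i}J_i(x^i)]_{i\in V}$ is strictly monotone on $\Omega$: $(F(x)-F(y))^T(x-y)>0$ for all $x\ne y$ in $\Omega$. 4. For every $i$, $\nabla_{x_i}J_i(x_i,u)$ is Lipschitz in $x_i\in\Omega_i$ for every fixed $u$, and there is $L_i>0$ such that it is $L_i$-Lipschitz in $u$ for every fixed $x_i\in\Omega_i$. Consider the following algorithm. Each player $i$ starts with (possibly random) estimates $\tilde x^i_j(0)\in\Omega_j$, $j\in\tilde N_I(i)$; the action of player $i$ at time $k$ is $x_i(k)=\tilde x_i^i(k)$. In iteration $k=0,1,2,\dots$ a player $i_k$ wakes up and selects a neighbour $j_k$ in $G_C$; the pair $(i_k,j_k)$ is independent of the initial estimates and of the earlier pairs, and its distribution does not depend on $k$ and gives positive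 probability to exactly the ordered pairs $(i,j)$ of players adjacent in $G_C$. Then: - *Gossip.* $\hat x^{i_k}_l(k)=\tfrac12\big(\tilde x^{i_k}_l(k)+\tilde x^{j_k}_l(k)\big)$ for $l\in N_I(i_k)\cap\tilde N_I(j_k)$, $\hat x^{j_k}_l(k)=\tfrac12\big(\tilde x^{i_k}_l(k)+\tilde x^{j_k}_l(k)\big)$ for $l\in N_I(j_k)\cap\tilde N_I(i_k)$, and $\hat x^i_l(k)=\tilde x^i_l(k)$ for all other $i\in V$, $l\in\tilde N_I(i)$. - *Local step.* For $i\in\{i_k,j_k\}$, $x_i(k+1)=T_{\Omega_i}\big[x_i(k)-\alpha_{k,i}\nabla_{x_i}J_i(x_i(k),\hat x^i_{-i}(k))\big]$, where $\hat x^i_{-i}(k)=(\hat x^i_l(k))_{l\in N_I(i)}$, $T_{\Omega_i}$ is the Euclidean projection onto $\Omega_i$, and $\alpha_{k,i}=1/\nu_k(i)$ with $\nu_k(i)$ the number of $l\in\{0,\dots,k\}$ with $i\in\{i_l,j_l\}$. For $i\notin\{i_k,j_k\}$, $x_i(k+1)=x_i(k)$. - *Estimates.* $\tilde x^i_i(k+1)=x_i(k+1)$,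 and $\tilde x^i_j(k+1)=\hat x^i_j(k)$ for $j\in N_I(i)$. Then the game has a unique Nash equilibrium $x^*$, and $x(k)\to x^*$ as $k\to\infty$, almost surely. -/

import Mathlib

open MeasureTheory ProbabilityTheory Filter Topology

namespace GossipNash

/-- `H` is a maximal triangle-free spanning subgraph of `G`: a triangle-free spanning subgraph
such that adding any missing edge of `G` to `H` creates a triangle. -/
def IsMaximalTriangleFree {V : Type*} (G H : SimpleGraph V) : Prop :=
  H ≤ G ∧ H.CliqueFree 3 ∧
    ∀ u v : V, G.Adj u v → ¬ H.Adj u v → ¬ (H ⊔ SimpleGraph.edge u v).CliqueFree 3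

/-- The condition on the communication graph `GC`: it lies between some maximal triangle-free
spanning subgraph of the interference graph `GI` and `GI` itself if such a subgraph exists, and
it equals `GI` otherwise. -/
def CommunicationGraph {V : Type*} (GI GC : SimpleGraph V) : Prop :=
  (∃ Gm, IsMaximalTriangleFree GI Gm ∧ Gm ≤ GC ∧ GC ≤ GI) ∨
    ((¬ ∃ Gm, IsMaximalTriangleFree GI Gm) ∧ GC = GI)

/-- The closed neighbourhood of `i` in `G`, that is, `i` and its neighbours, as a type. -/
abbrev Nbhd {V : Type*} (G : SimpleGraph V) (i : V) : Type _ := {j : V // j = i ∨ G.Adj i j}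

/-- `i` as a member of its closed neighbourhood. -/
abbrev own {V : Type*} (G : SimpleGraph V) (i : V) : Nbhd G i := ⟨i, Or.inl rfl⟩

/-- A game with interference graph `G`: every player has an action set in `ℝ` and a cost that is a
function of the actions of the closed neighbourhood of that player. Only the values of the cost at
admissible actions are ever used. -/
structure Game {V : Type*} (G : SimpleGraph V) where
  /-- the action sets -/
  act : V → Set ℝ
  /-- the cost functions -/
  cost : (i : V) → (Nbhd G i → ℝ) → ℝ

namespace Game

/-- The product of all action sets. -/
def actions {V : Type*} {G : SimpleGraph V} (Γ : Game G) : Set (V → ℝ) :=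
  {x | ∀ i, x i ∈ Γ.act i}

/-- The product of the action sets of the players in the closed neighbourhood of `i`. -/
def localActions {V : Type*} {G : SimpleGraph V} (Γ : Game G) (i : V) : Set (Nbhd G i → ℝ) :=
  {y | ∀ j : Nbhd G i, y j ∈ Γ.act j.1}

/-- The cost of player `i` as a function of the own action of `i`; the own coordinate of `y` is
replaced, the other coordinates are kept. -/
def ownCost {V : Type*} [DecidableEq V] {G : SimpleGraph V} (Γ : Game G) (i : V)
    (y : Nbhd G i → ℝ) (t : ℝ) : ℝ :=
  Γ.cost i (Function.update y (own G i) t)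

/-- The partial gradient of the cost of player `i` with respect to the own action of `i`, at `y`
(one-sided at the end points of the action set). -/
noncomputable def partialGrad {V : Type*} [DecidableEq V] {G : SimpleGraph V} (Γ : Game G) (i : V)
    (y : Nbhd G i → ℝ) : ℝ :=
  derivWithin (Γ.ownCost i y) (Γ.act i) (y (own G i))

/-- The pseudo-gradient mapping. -/
noncomputable def pseudoGrad {V : Type*} [DecidableEq V] {G : SimpleGraph V} (Γ : Game G)
    (x : V → ℝ) (i : V) : ℝ :=
  Γ.partialGrad i (fun j => x j.1)

/-- `x` is a Nash equilibrium. -/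
def IsNash {V : Type*} [DecidableEq V] {G : SimpleGraph V} (Γ : Game G) (x : V → ℝ) : Prop :=
  x ∈ Γ.actions ∧
    ∀ i, ∀ t ∈ Γ.act i, Γ.cost i (fun j => x j.1) ≤ Γ.ownCost i (fun j => x j.1) t

/-- The action sets are nonempty, compact and convex; each cost is jointly continuous, and
continuously differentiable and convex in the own action. -/
def Regular {V : Type*} [DecidableEq V] {G : SimpleGraph V} (Γ : Game G) : Prop :=
  ∀ i, (Γ.act i).Nonempty ∧ IsCompact (Γ.act i) ∧ Convex ℝ (Γ.act i) ∧
    ContinuousOn (Γ.cost i) (Γ.localActions i) ∧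
    ∀ y ∈ Γ.localActions i,
      ContDiffOn ℝ 1 (Γ.ownCost i y) (Γ.act i) ∧ ConvexOn ℝ (Γ.act i) (Γ.ownCost i y)

/-- The pseudo-gradient is strictly monotone on the product of the action sets. -/
def StrictlyMonotone {V : Type*} [Fintype V] [DecidableEq V] {G : SimpleGraph V} (Γ : Game G) :
    Prop :=
  ∀ x ∈ Γ.actions, ∀ y ∈ Γ.actions, x ≠ y →
    0 < ∑ i, (Γ.pseudoGrad x i - Γ.pseudoGrad y i) * (x i - y i)

/-- The partial gradient of each player is Lipschitz in the own action, for every fixed choice of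
the actions of the neighbours, and Lipschitz in the actions of the neighbours, with a constant
that does not depend on the fixed own action. -/
def LipschitzGrad {V : Type*} [Fintype V] [DecidableEq V] {G : SimpleGraph V}
    [DecidableRel G.Adj] (Γ : Game G) : Prop :=
  ∀ i,
    (∀ y ∈ Γ.localActions i, ∃ σ : ℝ, 0 < σ ∧ ∀ s ∈ Γ.act i, ∀ t ∈ Γ.act i,
      |Γ.partialGrad i (Function.update y (own G i) s) -
        Γ.partialGrad i (Function.update y (own G i) t)| ≤ σ * |s - t|) ∧
    (∃ L : ℝ, 0 < L ∧ ∀ y ∈ Γ.localActions i, ∀ z ∈ Γ.localActions i,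
      y (own G i) = z (own G i) →
        |Γ.partialGrad i y - Γ.partialGrad i z| ≤ L * Real.sqrt (∑ j, (y j - z j) ^ 2))

end Game

/-- The Euclidean projection of `x` onto `s`: a point of `s` nearest to `x` (it exists and is
unique when `s` is nonempty, closed and convex; the value is arbitrary if there is none). -/
noncomputable def proj (s : Set ℝ) (x : ℝ) : ℝ :=
  Classical.epsilon fun y => y ∈ s ∧ ∀ z ∈ s, |x - y| ≤ |x - z|

/-- Families of estimates: `e i l` is the estimate that player `i` has of the action of player `l`,
for `l` in the closed neighbourhood of `i`. -/
abbrev Estimates {V : Type*} (G : SimpleGraph V) : Type _ := (i : V) → Nbhd G i → ℝ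

/-- The estimates of player `i` after an exchange with player `j`: for a neighbour `l` of `i` that
lies in the closed neighbourhood of `j`, the two estimates of the action of `l` are averaged; the
others are kept. -/
noncomputable def exchange {V : Type*} [DecidableEq V] {G : SimpleGraph V} [DecidableRel G.Adj]
    (e : Estimates G) (i j : V) : Nbhd G i → ℝ := fun l =>
  if h : l.1 ≠ i ∧ (l.1 = j ∨ G.Adj j l.1) then (e i l + e j ⟨l.1, h.2⟩) / 2 else e i l

/-- The gossiping step, for the pair `p` of communicating players. -/
noncomputable def gossipStep {V : Type*} [DecidableEq V] {G : SimpleGraph V} [DecidableRel G.Adj]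
    (e : Estimates G) (p : V × V) : Estimates G := fun i =>
  if i = p.1 then exchange e i p.2 else if i = p.2 then exchange e i p.1 else e i

/-- The new action of player `i`: a projected gradient step of size `a` if `i` is one of the two
communicating players, the old action otherwise. -/
noncomputable def newAction {V : Type*} [DecidableEq V] {G : SimpleGraph V} [DecidableRel G.Adj]
    (Γ : Game G) (e : Estimates G) (p : V × V) (a : ℝ) (i : V) : ℝ :=
  if i = p.1 ∨ i = p.2 then
    proj (Γ.act i) (e i (own G i) -
      a * Γ.partialGrad i (Function.update (gossipStep e p i) (own G i) (e i (own G i))))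
  else e i (own G i)

/-- The number of updates that player `i` makes in the iterations `0, …, k`, when `p l` is the pair
of players that communicate in iteration `l`. -/
def updateCount {V : Type*} [DecidableEq V] (p : ℕ → V × V) (k : ℕ) (i : V) : ℕ :=
  ((Finset.range (k + 1)).filter fun l => i = (p l).1 ∨ i = (p l).2).card

/-- The temporary estimates at time `k`, started at `e₀`, when `p l` is the pair of players that
communicate in iteration `l`. The step size of player `i` in iteration `k` is the inverse of the
number of updates that `i` has made up to and including iteration `k`. -/
noncomputable def tempEstimates {V : Type*} [DecidableEq V] {G : SimpleGraph V}
    [DecidableRel G.Adj] (Γ : Game G) (e₀ : Estimates G) (p : ℕ → V × V) : ℕ → Estimates G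
  | 0 => e₀
  | k + 1 => fun i l =>
      if l.1 = i then
        newAction Γ (tempEstimates Γ e₀ p k) (p k) (1 / (updateCount p k i : ℝ)) i
      else gossipStep (tempEstimates Γ e₀ p k) (p k) i l

/-- The actions of the players at time `k`. -/
noncomputable def algActions {V : Type*} [DecidableEq V] {G : SimpleGraph V} [DecidableRel G.Adj]
    (Γ : Game G) (e₀ : Estimates G) (p : ℕ → V × V) (k : ℕ) (i : V) : ℝ :=
  tempEstimates Γ e₀ p k i (own G i)

/-- The sigma-field generated by the initial estimates and the pairs of communicating players in
the iterations before `k`. -/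
@[reducible] def history {S V : Type*} [MeasurableSpace V] {G : SimpleGraph V}
    (e₀ : S → Estimates G) (p : ℕ → S → V × V) (k : ℕ) : MeasurableSpace S :=
  MeasurableSpace.comap e₀ inferInstance ⊔
    ⨆ l : Fin k, MeasurableSpace.comap (p l) inferInstance

/-- The randomness of the algorithm: `e₀` are the initial estimates, which are admissible, and `p k`
is the pair of a player that wakes up in iteration `k` and of the communication neighbour that this
player selects. In every iteration the pair is drawn independently of the past, from the same
distribution `q`, which charges exactly the pairs of neighbours in `GC`. -/
structure IsGossipProcess {S V : Type*} [MeasurableSpace S] [MeasurableSpace V]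
    {G : SimpleGraph V} (Γ : Game G) (GC : SimpleGraph V) (q : V → V → ℝ)
    (e₀ : S → Estimates G) (p : ℕ → S → V × V) (μ : Measure S) : Prop where
  measurable_init : Measurable e₀
  init_mem : ∀ s i, e₀ s i ∈ Γ.localActions i
  measurable_pair : ∀ k, Measurable (p k)
  law : ∀ k i j, μ.real {s | p k s = (i, j)} = q i j
  support : ∀ i j, 0 < q i j ↔ GC.Adj i j
  indep : ∀ k, Indep (MeasurableSpace.comap (p k) inferInstance) (history e₀ p k) μ

end GossipNash

/-! Chance enters only through the strong law of large numbers. Almost surely every player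
communicates with a positive frequency, and so does a fixed word of pairs among the blocks of its
length. On such a sample path the rest is deterministic, with no martingales and no rate for the
consensus.

Equilibria are the solutions of the variational inequality of the pseudo-gradient `F`. Strict
monotonicity makes the solution `z` unique and gives `∑ i, F y i * (y i - z i) > 0` for `y ≠ z`.
Existence comes from averaged projected gradient steps, compactness and Minty's trick.

Consensus: interference neighbours are at distance at most two in the communication graph, so a word
that lists all communication edges twice passes every action on to all players who estimate it. Each
occurrence of the word contracts the estimation error by a fixed factor, up to moves of size
`O(1/k)`, so the error tends to `0` (`tendsto_estError`).

Optimisation: the squared distance to `z` drops by `2 ∑ i, a i k * h i (x k)` up to `o(1/k)`, where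
`h i x = F x i * (x i - z i)`. Only the sum of the `h i` is known to be positive, and the step sizes
`a i k` differ between players. But the steps of a player of frequency `r` add up to a harmonic
number, that is, to `log k` plus a constant plus `log r` plus `o(1)`. All clocks therefore agree up
to constants, and a correction that vanishes in the limit replaces every `a i k` by `1/(k+1)`
(`tendsto_of_lyapunov`). -/

namespace GossipNash

/-! ### Descent along divergent clocks; harmonic clocks -/

/-- A nonnegative sequence `m` tends to `0` if, for every threshold `δ`, it is asymptotic to a
sequence `W` that hardly increases and that decreases along a divergent clock while `m` is at
least `δ`. -/
theorem tendsto_zero_of_descent {m : ℕ → ℝ} (hm : ∀ k, 0 ≤ m k)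
    (h : ∀ δ > 0, ∃ (W s w : ℕ → ℝ) (c : ℝ), Tendsto (fun k => W k - m k) atTop (𝓝 0) ∧
      Tendsto s atTop (𝓝 0) ∧ 0 < c ∧ (∀ k, 0 ≤ w k) ∧
      Tendsto (fun n => ∑ k ∈ Finset.range n, w k) atTop atTop ∧
      (∀ k, W (k + 1) ≤ W k + s k) ∧ ∀ᶠ k in atTop, δ ≤ m k → W (k + 1) ≤ W k - c * w k) :
    Tendsto m atTop (𝓝 0) := by
  rw [Metric.tendsto_atTop]
  intro ε hε
  obtain ⟨W, s, w, c, hWm, hs, hc, hw, hsum, hstep, hdesc⟩ := h (ε / 5) (by positivity)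
  have e1 : ∀ᶠ k in atTop, |W k - m k| < ε / 5 := by
    have := (Metric.tendsto_nhds.1 hWm) (ε / 5) (by positivity)
    simpa [Real.dist_eq] using this
  have e2 : ∀ᶠ k in atTop, |s k| < ε / 5 := by
    have := (Metric.tendsto_nhds.1 hs) (ε / 5) (by positivity)
    simpa [Real.dist_eq] using this
  obtain ⟨K, hK⟩ := eventually_atTop.1 (e1.and (e2.and hdesc))
  -- If `m` stayed above the threshold, the divergent clock would drive `W` to `-∞`, although `W > m
  -- - ε/5 ≥ -ε/5`.
  obtain ⟨k₁, hk₁, hmk₁⟩ : ∃ k₁ ≥ K, m k₁ < ε / 5 := by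
    by_contra! hcon
    have key : ∀ n, W (K + n) ≤ W K -
        c * (∑ k ∈ Finset.range (K + n), w k - ∑ k ∈ Finset.range K, w k) := by
      intro n
      induction n with
      | zero => simp
      | succ n ih =>
        have := (hK (K + n) (by omega)).2.2 (hcon _ (by omega))
        rw [← add_assoc, Finset.sum_range_succ]
        linarith
    have hbig := (hsum.comp (tendsto_add_atTop_nat K)).eventually_gt_atTop
      (∑ k ∈ Finset.range K, w k + (W K + ε / 5) / c)
    obtain ⟨n, hn⟩ := hbig.exists
    have h1 := key n
    have h2 := (abs_lt.1 (hK (K + n) (by omega)).1).1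
    have h3 := hm (K + n)
    simp only [Function.comp_apply, add_comm n K] at hn
    have h4 : (W K + ε / 5) / c <
        ∑ k ∈ Finset.range (K + n), w k - ∑ k ∈ Finset.range K, w k := by linarith
    rw [div_lt_iff₀ hc] at h4
    linarith
  refine ⟨k₁, fun k hk => ?_⟩
  -- Below the threshold `W < 2ε/5`, and one step adds less than `ε/5`; above it `W` does not
  -- increase. Hence `m < 4ε/5` from `k₁` on.
  have hW : W k ≤ 3 * (ε / 5) := by
    induction k, hk using Nat.le_induction with
    | base =>
      have := (abs_lt.1 (hK k₁ hk₁).1).2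
      linarith
    | succ k hk ih =>
      obtain ⟨h1, h2, h3⟩ := hK k (by omega)
      rcases lt_or_ge (m k) (ε / 5) with h4 | h4
      · have := hstep k
        have := (abs_lt.1 h1).2
        have := (abs_lt.1 h2).2
        linarith
      · have := h3 h4
        have := mul_nonneg hc.le (hw k)
        linarith
  have := (abs_lt.1 (hK k (by omega)).1).1
  rw [Real.dist_eq, sub_zero, abs_of_nonneg (hm k)]
  linarith

theorem tendsto_harmonic_atTop : Tendsto (fun n => (harmonic n : ℝ)) atTop atTop := by
  have := Real.tendsto_harmonic_sub_log.add_atTop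
    (Real.tendsto_log_atTop.comp tendsto_natCast_atTop_atTop)
  simpa using this

theorem tendsto_natCast_atTop_of_density {N : ℕ → ℕ} {r : ℝ} (hr : 0 < r)
    (hN : Tendsto (fun b => (N b : ℝ) / b) atTop (𝓝 r)) : Tendsto N atTop atTop := by
  rw [← tendsto_natCast_atTop_iff (R := ℝ)]
  have := hN.pos_mul_atTop hr (tendsto_natCast_atTop_atTop (R := ℝ))
  refine this.congr' ?_
  filter_upwards [eventually_gt_atTop 0] with b hb
  have : (b : ℝ) ≠ 0 := by positivity
  field_simp

/-- The harmonic clock of a subsequence of density `r` runs, up to a constant, like the harmonic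
clock. -/
theorem tendsto_harmonic_sub_harmonic {N : ℕ → ℕ} {r : ℝ} (hr : 0 < r)
    (hN : Tendsto (fun b => (N b : ℝ) / b) atTop (𝓝 r)) :
    Tendsto (fun b => (harmonic (N b) : ℝ) - (harmonic b : ℝ)) atTop (𝓝 (Real.log r)) := by
  have hNtop := tendsto_natCast_atTop_of_density hr hN
  -- Euler's constant cancels in the difference, and `log (N b / b)` remains.
  have h1 := (Real.tendsto_harmonic_sub_log.comp hNtop).sub Real.tendsto_harmonic_sub_log
  have h2 := (hN.log hr.ne').add h1
  rw [sub_self, add_zero] at h2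
  refine h2.congr' ?_
  filter_upwards [eventually_gt_atTop 0, hNtop.eventually_gt_atTop 0] with b hb hNb
  have : (b : ℝ) ≠ 0 := by positivity
  have : (N b : ℝ) ≠ 0 := by positivity
  rw [Real.log_div (by assumption) (by assumption)]
  simp only [Function.comp_apply]
  ring

/-- The step size of a player is the increment of the harmonic number at the number of moves; this
makes the clock of the player explicit. -/
theorem harmonic_count_succ {g : ℕ → Prop} [DecidablePred g] (b : ℕ) :
    (harmonic (Nat.count g (b + 1)) : ℝ) = harmonic (Nat.count g b) +
      if g b then 1 / (Nat.count g (b + 1) : ℝ) else 0 := by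
  by_cases h : g b
  · rw [Nat.count_succ, if_pos h, if_pos h, harmonic_succ]
    push_cast
    rw [one_div]
  · rw [Nat.count_succ, if_neg h, if_neg h]
    simp

theorem sum_clock_eq_harmonic {g : ℕ → Prop} [DecidablePred g] (n : ℕ) :
    ∑ b ∈ Finset.range n, (if g b then 1 / (Nat.count g (b + 1) : ℝ) else 0) =
      harmonic (Nat.count g n) := by
  induction n with
  | zero => simp
  | succ n ih => rw [Finset.sum_range_succ, ih, harmonic_count_succ]

theorem exists_clock_le {g : ℕ → Prop} [DecidablePred g] {r : ℝ} (hr : 0 < r)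
    (hN : Tendsto (fun b => (Nat.count g b : ℝ) / b) atTop (𝓝 r)) :
    ∃ B, ∀ b : ℕ, (if g b then 1 / (Nat.count g (b + 1) : ℝ) else 0) ≤ B / ((b : ℝ) + 1) := by
  have h := (hN.inv₀ hr.ne').bddAbove_range
  obtain ⟨B, hB⟩ := h
  -- At `b = 0` the quotient is `0 / 0 = 0`, and its inverse is `0` as well.
  have h0 : 0 ≤ B := by
    have := hB ⟨0, rfl⟩
    simpa using this
  refine ⟨B, fun b => ?_⟩
  split_ifs with hg
  · have := hB ⟨b + 1, rfl⟩
    simp only [inv_div] at this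
    rw [le_div_iff₀ (by positivity)]
    push_cast at this
    rw [one_div_mul_eq_div]
    exact this
  · positivity

/-- A nonnegative sequence that is contracted along a set of indices of positive density and that
is otherwise perturbed by `O(1 / b)` tends to `0`. -/
theorem tendsto_zero_of_contraction {m : ℕ → ℝ} (hm : ∀ b, 0 ≤ m b) {g : ℕ → Prop}
    [DecidablePred g] {r : ℝ} (hr : 0 < r)
    (hN : Tendsto (fun b => (Nat.count g b : ℝ) / b) atTop (𝓝 r)) {C ρ : ℝ} (hC : 0 < C)
    (hρ : ρ < 1) (hstep : ∀ b, m (b + 1) ≤ m b + C / ((b : ℝ) + 1))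
    (hgood : ∀ b, g b → m (b + 1) ≤ ρ * m b + C / ((b : ℝ) + 1)) :
    Tendsto m atTop (𝓝 0) := by
  have hNtop := tendsto_natCast_atTop_of_density hr hN
  refine tendsto_zero_of_descent hm fun δ hδ => ?_
  set w : ℕ → ℝ := fun b => if g b then 1 / (Nat.count g (b + 1) : ℝ) else 0 with hw
  have hw0 : ∀ b, 0 ≤ w b := fun b => by
    simp only [hw]; split_ifs <;> positivity
  have hwlim : Tendsto w atTop (𝓝 0) := by
    obtain ⟨B, hB⟩ := exists_clock_le hr hN
    refine squeeze_zero hw0 hB ?_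
    have := (tendsto_one_div_add_atTop_nhds_zero_nat (𝕜 := ℝ)).const_mul B
    simpa [div_eq_mul_inv] using this
  have hhar : ∀ b : ℕ, (harmonic (b + 1) : ℝ) = harmonic b + 1 / ((b : ℝ) + 1) := fun b => by
    rw [harmonic_succ]; push_cast; rw [one_div]
  -- The term `-C * harmonic b` absorbs the perturbation `C / (b + 1)` of every step, at the price
  -- of `C * w b` at good times. There the contraction gains at least `(1 - ρ) * δ`, eventually more
  -- than `2 * C * w b`, so a net decrease of `C * w b` is left.
  refine ⟨fun b => m b + C * ((harmonic (Nat.count g b) : ℝ) - harmonic b - Real.log r),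
    fun b => C * w b, w, C, ?_, ?_, hC, hw0, ?_, ?_, ?_⟩
  · have := ((tendsto_harmonic_sub_harmonic hr hN).sub_const (Real.log r)).const_mul C
    simpa using this
  · simpa using hwlim.const_mul C
  · simp only [hw, sum_clock_eq_harmonic]
    exact tendsto_harmonic_atTop.comp hNtop
  · intro b
    have h1 := hstep b
    have h2 : (harmonic (Nat.count g (b + 1)) : ℝ) = harmonic (Nat.count g b) + w b :=
      harmonic_count_succ b
    have h3 : C / ((b : ℝ) + 1) = C * (1 / ((b : ℝ) + 1)) := by ring
    simp only [h2, hhar]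
    rw [h3] at h1
    linarith
  · have hbig : ∀ᶠ b in atTop, 2 * C * w b ≤ (1 - ρ) * δ := by
      have h0 : Tendsto (fun b => 2 * C * w b) atTop (𝓝 0) := by
        simpa using hwlim.const_mul (2 * C)
      exact (h0.eventually_lt_const (mul_pos (by linarith) hδ)).mono fun _ => le_of_lt
    filter_upwards [hbig] with b hb hmb
    have h2 : (harmonic (Nat.count g (b + 1)) : ℝ) = harmonic (Nat.count g b) + w b :=
      harmonic_count_succ b
    have h3 : C / ((b : ℝ) + 1) = C * (1 / ((b : ℝ) + 1)) := by ring
    simp only [h2, hhar]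
    by_cases hg : g b
    · have h1 := hgood b hg
      rw [h3] at h1
      have : (1 - ρ) * δ ≤ (1 - ρ) * m b := mul_le_mul_of_nonneg_left hmb (by linarith)
      linarith
    · have h1 := hstep b
      have : w b = 0 := by simp [hw, hg]
      rw [h3] at h1
      rw [this]
      linarith

/-! ### Asynchronous stochastic approximation -/

/-- A continuous function on a compact set is uniformly approximated by Lipschitz functions. -/
theorem exists_lipschitz_approx {α : Type*} [PseudoMetricSpace α] {K : Set α} (hK : IsCompact K)
    {h : α → ℝ} (hh : ContinuousOn h K) {ε : ℝ} (hε : 0 < ε) :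
    ∃ (g : α → ℝ) (C : ℝ), 0 ≤ C ∧ (∀ x ∈ K, |g x - h x| ≤ ε) ∧
      ∀ x ∈ K, ∀ y ∈ K, |g x - g y| ≤ C * dist x y := by
  obtain ⟨B, hB⟩ := hK.exists_bound_of_continuousOn hh
  have hu := hK.uniformContinuousOn_of_continuous hh
  obtain ⟨δ, hδ, hδh⟩ := Metric.uniformContinuousOn_iff.1 hu ε hε
  -- The approximation is the infimal convolution of `h` with `C * dist`. Since `C * δ = 2 * |B|`
  -- bounds the oscillation of `h`, points at distance at least `δ` cannot push the infimum below `h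
  -- x`; nearer points lower it by at most `ε`.
  set C : ℝ := 2 * |B| / δ with hCdef
  have hC : 0 ≤ C := by positivity
  have hlow : ∀ x ∈ K, ∀ y ∈ K, h x - ε ≤ h y + C * dist x y := by
    intro x hx y hy
    rcases lt_or_ge (dist x y) δ with hd | hd
    · have h1 := hδh x hx y hy hd
      rw [Real.dist_eq] at h1
      have := (abs_lt.1 h1).2
      have : 0 ≤ C * dist x y := by positivity
      linarith
    · have h1 : 2 * |B| ≤ C * dist x y := by
        calc 2 * |B| = C * δ := by rw [hCdef]; field_simp
          _ ≤ _ := by gcongr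
      have h2 := hB x hx
      have h3 := hB y hy
      rw [Real.norm_eq_abs] at h2 h3
      have := (abs_le.1 h2).2
      have := (abs_le.1 h3).1
      have := le_abs_self B
      linarith
  have hbdd : ∀ x ∈ K, BddBelow (Set.range fun y : K => h y + C * dist x y) := fun x hx =>
    ⟨h x - ε, by rintro _ ⟨y, rfl⟩; exact hlow x hx y y.2⟩
  refine ⟨fun x => ⨅ y : K, h y + C * dist x y, C, hC, fun x hx => ?_, fun x hx y hy => ?_⟩
  · have : Nonempty K := ⟨⟨x, hx⟩⟩
    have h1 : ⨅ y : K, h y + C * dist x y ≤ h x := by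
      simpa using ciInf_le (hbdd x hx) ⟨x, hx⟩
    have h2 : h x - ε ≤ ⨅ y : K, h y + C * dist x y := le_ciInf fun y => hlow x hx y y.2
    rw [abs_le]
    constructor <;> linarith
  · have : Nonempty K := ⟨⟨x, hx⟩⟩
    have key : ∀ x ∈ K, ∀ y ∈ K, (⨅ z : K, h z + C * dist x z) - C * dist x y ≤
        ⨅ z : K, h z + C * dist y z := fun x hx y hy => le_ciInf fun z => by
      have h1 := ciInf_le (hbdd x hx) z
      have h2 := mul_le_mul_of_nonneg_left (dist_triangle x y z) hC
      linarith
    have h1 := key x hx y hy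
    have h2 := key y hy x hx
    rw [dist_comm y x] at h2
    rw [abs_le]
    constructor <;> linarith

theorem exists_pos_le_of_compact {α : Type*} [TopologicalSpace α] {S : Set α} (hS : IsCompact S)
    {H : α → ℝ} (hH : ContinuousOn H S) (hpos : ∀ y ∈ S, 0 < H y) : ∃ φ > 0, ∀ y ∈ S, φ ≤ H y := by
  rcases S.eq_empty_or_nonempty with rfl | hne
  · exact ⟨1, one_pos, by simp⟩
  · obtain ⟨y, hy, hmin⟩ := hS.exists_isMinOn hne hH
    exact ⟨H y, hpos y hy, fun z hz => hmin hz⟩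

/-- Convergence of an asynchronous stochastic-approximation scheme: coordinate `i` moves at the
times in `g i`, a set of positive density, with the inverse of the number of its moves as step
size. The squared distance to `z` is the Lyapunov function; it is corrected by the difference
between the clocks of the coordinates and a common clock. -/
theorem tendsto_of_lyapunov {V : Type*} [Fintype V] {K : Set (V → ℝ)} (hK : IsCompact K)
    {x : ℕ → V → ℝ} (hx : ∀ k, x k ∈ K) {z : V → ℝ} {h : V → (V → ℝ) → ℝ}
    (hh : ∀ i, ContinuousOn (h i) K) (hpos : ∀ y ∈ K, y ≠ z → 0 < ∑ i, h i y)
    {g : V → ℕ → Prop} [∀ i, DecidablePred (g i)] {r : V → ℝ} (hr : ∀ i, 0 < r i)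
    (hN : ∀ i, Tendsto (fun b => (Nat.count (g i) b : ℝ) / b) atTop (𝓝 (r i)))
    {C : ℝ} (hC : 0 ≤ C) (hmove : ∀ k i, |x (k + 1) i - x k i| ≤ C / ((k : ℝ) + 1))
    {e : ℕ → ℝ} (he : Tendsto e atTop (𝓝 0))
    (hdesc : ∀ k, ∑ i, (x (k + 1) i - z i) ^ 2 ≤ ∑ i, (x k i - z i) ^ 2 -
      2 * ∑ i, (if g i k then 1 / (Nat.count (g i) (k + 1) : ℝ) else 0) * h i (x k) +
      e k / ((k : ℝ) + 1)) :
    Tendsto x atTop (𝓝 z) := by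
  set a : V → ℕ → ℝ := fun i k => if g i k then 1 / (Nat.count (g i) (k + 1) : ℝ) else 0 with ha
  have ha0 : ∀ i k, 0 ≤ a i k := fun i k => by simp only [ha]; split_ifs <;> positivity
  choose B hB using fun i => exists_clock_le (hr i) (hN i)
  replace hB : ∀ i k, a i k ≤ B i / ((k : ℝ) + 1) := hB
  have hB0 : ∀ i, 0 ≤ B i := fun i => by simpa using (ha0 i 0).trans (hB i 0)
  have hBB : 0 ≤ ∑ i, B i := Finset.sum_nonneg fun i _ => hB0 i
  have hm : Tendsto (fun k => ∑ i, (x k i - z i) ^ 2) atTop (𝓝 0) := by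
    refine tendsto_zero_of_descent (fun k => Finset.sum_nonneg fun i _ => sq_nonneg _)
      fun δ hδ => ?_
    have hcd : Continuous fun y : V → ℝ => ∑ i, (y i - z i) ^ 2 := by fun_prop
    obtain ⟨φ, hφ, hφH⟩ : ∃ φ > 0, ∀ y ∈ K ∩ {y | δ ≤ ∑ i, (y i - z i) ^ 2}, φ ≤ ∑ i, h i y := by
      refine exists_pos_le_of_compact (hK.inter_right (isClosed_le continuous_const hcd))
        ((continuousOn_finsetSum _ fun i _ => hh i).mono Set.inter_subset_left) ?_
      rintro y ⟨hyK, hyδ⟩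
      refine hpos y hyK ?_
      rintro rfl
      simp only [sub_self, Set.mem_ofPred_eq] at hyδ
      norm_num at hyδ
      linarith
    set n : ℝ := (Fintype.card V : ℝ) with hn
    have hn0 : 0 ≤ n := by positivity
    -- The error `ε` is paid twice: `n * ε` for replacing `∑ f` by `∑ h`, and `ε * ∑ B` for
    -- replacing `f` by `h` next to the step sizes. With the factor `2` both fit into `φ / 2`.
    set ε : ℝ := φ / (4 * (n + ∑ i, B i + 1)) with hε
    have hε0 : 0 < ε := by positivity
    have hεφ : 2 * (n * ε) + 2 * (ε * ∑ i, B i) ≤ φ / 2 := by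
      have : ε * (4 * (n + ∑ i, B i + 1)) = φ := by rw [hε]; field_simp
      nlinarith
    choose f c hc hfh hf using fun i => exists_lipschitz_approx hK (hh i) hε0
    obtain ⟨G, hG⟩ := hK.exists_bound_of_continuousOn
      (continuousOn_finsetSum Finset.univ fun i _ => hh i)
    set Δ : V → ℕ → ℝ := fun i k =>
      (harmonic (Nat.count (g i) k) : ℝ) - harmonic k - Real.log (r i) with hΔ
    have hΔlim : ∀ i, Tendsto (Δ i) atTop (𝓝 0) := fun i => by
      simpa using (tendsto_harmonic_sub_harmonic (hr i) (hN i)).sub_const (Real.log (r i))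
    have hΔs : ∀ i k, Δ i (k + 1) = Δ i k + (a i k - 1 / ((k : ℝ) + 1)) := fun i k => by
      simp only [hΔ, ha]
      rw [harmonic_count_succ, harmonic_succ]
      push_cast
      rw [one_div ((k : ℝ) + 1)]
      ring
    set t : ℕ → ℝ := fun k => e k + 2 * ∑ i, |Δ i (k + 1)| * (c i * C) with ht
    have htlim : Tendsto t atTop (𝓝 0) := by
      have h1 : Tendsto (fun k => ∑ i, |Δ i (k + 1)| * (c i * C)) atTop
          (𝓝 (∑ i : V, |(0 : ℝ)| * (c i * C))) := tendsto_finsetSum _ fun i _ =>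
        (((hΔlim i).comp (tendsto_add_atTop_nat 1)).abs).mul_const _
      have := he.add (h1.const_mul 2)
      simpa using this
    have hsum_fh : ∀ k, ∑ i, h i (x k) - n * ε ≤ ∑ i, f i (x k) := fun k => by
      have h1 : ∑ i, (h i (x k) - ε) ≤ ∑ i, f i (x k) := Finset.sum_le_sum fun i _ => by
        have := (abs_le.1 (hfh i (x k) (hx k))).1
        linarith
      rw [Finset.sum_sub_distrib] at h1
      simpa [hn] using h1
    -- Summation by parts: the increment of `Δ i` is `a i k - 1 / (k + 1)`, so the correction
    -- exchanges the individual step sizes for the common one. What remains is `Δ i (k + 1)` times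
    -- the change of `f i` along one move. This is `o(1/k)` because `f i` is Lipschitz; continuity
    -- of `h i` would give no rate.
    set W : ℕ → ℝ := fun k => ∑ i, (x k i - z i) ^ 2 + 2 * ∑ i, Δ i k * f i (x k) with hW
    have hmain : ∀ k, W (k + 1) ≤ W k +
        (-2 * ∑ i, f i (x k) + 2 * (ε * ∑ i, B i) + t k) / ((k : ℝ) + 1) := by
      intro k
      have hk : (0 : ℝ) < (k : ℝ) + 1 := by positivity
      have hd : dist (x (k + 1)) (x k) ≤ C / ((k : ℝ) + 1) :=
        (dist_pi_le_iff (by positivity)).2 fun i => hmove k i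
      have h1 : ∀ i, Δ i (k + 1) * f i (x (k + 1)) ≤ Δ i k * f i (x k) + a i k * h i (x k) +
          (-f i (x k) + ε * B i + |Δ i (k + 1)| * (c i * C)) / ((k : ℝ) + 1) := by
        intro i
        have e1 : Δ i (k + 1) * (f i (x (k + 1)) - f i (x k)) ≤
            |Δ i (k + 1)| * (c i * C) / ((k : ℝ) + 1) := by
          refine (le_abs_self _).trans ?_
          rw [abs_mul, mul_div_assoc, mul_div_assoc]
          refine mul_le_mul_of_nonneg_left ((hf i _ (hx _) _ (hx _)).trans ?_) (abs_nonneg _)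
          exact mul_le_mul_of_nonneg_left hd (hc i)
        have e2 : a i k * (f i (x k) - h i (x k)) ≤ ε * B i / ((k : ℝ) + 1) := by
          calc _ ≤ a i k * ε :=
                mul_le_mul_of_nonneg_left (abs_le.1 (hfh i (x k) (hx k))).2 (ha0 i k)
            _ ≤ B i / ((k : ℝ) + 1) * ε := mul_le_mul_of_nonneg_right (hB i k) hε0.le
            _ = _ := by ring
        have e3 : Δ i (k + 1) * f i (x (k + 1)) = Δ i (k + 1) * (f i (x (k + 1)) - f i (x k)) +
            (Δ i k + (a i k - 1 / ((k : ℝ) + 1))) * f i (x k) := by rw [← hΔs]; ring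
        rw [e3, add_div, add_div, neg_div]
        have e4 : f i (x k) / ((k : ℝ) + 1) = 1 / ((k : ℝ) + 1) * f i (x k) := by ring
        rw [e4]
        linarith
      have h2 := Finset.sum_le_sum fun i (_ : i ∈ Finset.univ) => h1 i
      simp only [Finset.sum_add_distrib, ← Finset.sum_div, Finset.sum_neg_distrib,
        ← Finset.mul_sum] at h2
      have h3 := hdesc k
      have h4 : (-2 * ∑ i, f i (x k) + 2 * (ε * ∑ i, B i) + t k) / ((k : ℝ) + 1) =
          2 * ((-∑ i, f i (x k) + ε * ∑ i, B i + ∑ i, |Δ i (k + 1)| * (c i * C)) /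
            ((k : ℝ) + 1)) + e k / ((k : ℝ) + 1) := by
        simp only [ht]; ring
      simp only [hW]
      rw [h4]
      linarith
    refine ⟨W, fun k => (2 * (|G| + n * ε) + 2 * (ε * ∑ i, B i) + t k) * (1 / ((k : ℝ) + 1)),
      fun k => 1 / ((k : ℝ) + 1), φ, ?_, ?_, hφ, fun k => by positivity, ?_, fun k => ?_, ?_⟩
    · have hbd : ∀ i, ∃ A, ∀ k, |f i (x k)| ≤ A := fun i => by
        obtain ⟨A, hA⟩ := hK.exists_bound_of_continuousOn (hh i)
        refine ⟨A + ε, fun k => ?_⟩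
        have h1 := hfh i (x k) (hx k)
        have h2 := hA (x k) (hx k)
        rw [Real.norm_eq_abs] at h2
        have := abs_sub_abs_le_abs_sub (f i (x k)) (h i (x k))
        linarith
      have h1 : Tendsto (fun k => ∑ i, Δ i k * f i (x k)) atTop (𝓝 (∑ _i : V, (0 : ℝ))) := by
        refine tendsto_finsetSum _ fun i _ => ?_
        obtain ⟨A, hA⟩ := hbd i
        refine squeeze_zero_norm (a := fun k => |Δ i k| * A) (fun k => ?_) ?_
        · rw [Real.norm_eq_abs, abs_mul]
          exact mul_le_mul_of_nonneg_left (hA k) (abs_nonneg _)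
        · simpa using ((hΔlim i).abs).mul_const A
      have := h1.const_mul 2
      simpa [hW] using this
    · have h1 := (htlim.const_add (2 * (|G| + n * ε) + 2 * (ε * ∑ i, B i))).mul
        (tendsto_one_div_add_atTop_nhds_zero_nat (𝕜 := ℝ))
      simpa using h1
    · refine tendsto_harmonic_atTop.congr fun k => ?_
      rw [harmonic]
      push_cast
      simp only [one_div]
    · refine (hmain k).trans ?_
      rw [div_eq_mul_one_div]
      refine add_le_add le_rfl (mul_le_mul_of_nonneg_right ?_ (by positivity))
      have h1 := hsum_fh k
      have h2 := hG (x k) (hx k)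
      rw [Real.norm_eq_abs] at h2
      have := (abs_le.1 h2).1
      have := le_abs_self G
      linarith
    · have hsmall : ∀ᶠ k in atTop, t k < φ / 2 := htlim.eventually_lt_const (by positivity)
      filter_upwards [hsmall] with k hk hδk
      refine (hmain k).trans ?_
      have h1 := hsum_fh k
      have h2 := hφH (x k) ⟨hx k, hδk⟩
      have h3 : (-2 * ∑ i, f i (x k) + 2 * (ε * ∑ i, B i) + t k) / ((k : ℝ) + 1) ≤
          -φ / ((k : ℝ) + 1) := by
        gcongr
        linarith
      rw [mul_one_div]
      rw [neg_div] at h3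
      linarith
  rw [tendsto_pi_nhds]
  intro i
  rw [tendsto_iff_dist_tendsto_zero]
  have h1 := hm.sqrt
  rw [Real.sqrt_zero] at h1
  refine squeeze_zero (fun _ => dist_nonneg) (fun k => ?_) h1
  rw [Real.dist_eq]
  refine Real.abs_le_sqrt ?_
  exact Finset.single_le_sum (f := fun i => (x k i - z i) ^ 2) (fun i _ => sq_nonneg _)
    (Finset.mem_univ i)

/-! ### Projections and monotone variational inequalities -/

theorem proj_spec {s : Set ℝ} (hs : s.Nonempty) (hc : IsCompact s) (x : ℝ) :
    proj s x ∈ s ∧ ∀ z ∈ s, |x - proj s x| ≤ |x - z| := by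
  have hcont : ContinuousOn (fun y => |x - y|) s := by fun_prop
  obtain ⟨y, hy, hmin⟩ := hc.exists_isMinOn hs hcont
  exact Classical.epsilon_spec (p := fun y => y ∈ s ∧ ∀ z ∈ s, |x - y| ≤ |x - z|)
    ⟨y, hy, fun z hz => hmin hz⟩

/-- On the line the projection of `x` lies between `x` and `z`: otherwise `min x z` or `max x z`
would be a point of `s` nearer to `x`. -/
theorem abs_proj_sub_le {s : Set ℝ} (hs : s.Nonempty) (hc : IsCompact s) (hconv : Convex ℝ s)
    (x : ℝ) {z : ℝ} (hz : z ∈ s) : |proj s x - z| ≤ |x - z| := by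
  obtain ⟨hy, hmin⟩ := proj_spec hs hc x
  set y := proj s x
  have hord := hconv.ordConnected
  rcases lt_trichotomy y z with h | h | h
  · have hxy : x ≤ y := by
      by_contra! hxy
      have h1 := hmin (min x z) (hord.out hy hz ⟨le_min hxy.le h.le, min_le_right _ _⟩)
      rw [abs_of_pos (sub_pos.2 hxy), abs_of_nonneg (sub_nonneg.2 (min_le_left _ _))] at h1
      have := lt_min hxy h
      linarith
    rw [abs_of_neg (by linarith), abs_of_neg (by linarith)]
    linarith
  · simp [h]
  · have hxy : y ≤ x := by
      by_contra! hxy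
      have h1 := hmin (max x z) (hord.out hz hy ⟨le_max_right _ _, max_le hxy.le h.le⟩)
      rw [abs_of_neg (sub_neg.2 hxy), abs_of_nonpos (sub_nonpos.2 (le_max_left _ _))] at h1
      have := max_lt hxy h
      linarith
    rw [abs_of_pos (by linarith), abs_of_pos (by linarith)]
    linarith

theorem sq_proj_sub_le {s : Set ℝ} (hs : s.Nonempty) (hc : IsCompact s) (hconv : Convex ℝ s)
    (x : ℝ) {z : ℝ} (hz : z ∈ s) : (proj s x - z) ^ 2 ≤ (x - z) ^ 2 :=
  sq_le_sq.2 (abs_proj_sub_le hs hc hconv x hz)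

theorem isCompact_box {V : Type*} {A : V → Set ℝ} (hc : ∀ i, IsCompact (A i)) :
    IsCompact {x : V → ℝ | ∀ i, x i ∈ A i} := by
  convert isCompact_univ_pi hc using 1
  ext x
  simp

/-- The Minty form of a monotone variational inequality has approximate solutions: averages of
projected gradient steps. -/
theorem exists_approx_minty {V : Type*} [Fintype V] {A : V → Set ℝ} (hne : ∀ i, (A i).Nonempty)
    (hc : ∀ i, IsCompact (A i)) (hconv : ∀ i, Convex ℝ (A i)) {F : (V → ℝ) → V → ℝ}
    (hF : ∀ i, ContinuousOn (fun x => F x i) {x | ∀ i, x i ∈ A i})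
    (hmono : ∀ x : V → ℝ, (∀ i, x i ∈ A i) → ∀ y : V → ℝ, (∀ i, y i ∈ A i) →
      0 ≤ ∑ i, (F x i - F y i) * (x i - y i)) {ε : ℝ} (hε : 0 < ε) :
    ∃ z : V → ℝ, (∀ i, z i ∈ A i) ∧
      ∀ y : V → ℝ, (∀ i, y i ∈ A i) → ∑ i, F y i * (z i - y i) ≤ ε := by
  have hK := isCompact_box hc
  set K : Set (V → ℝ) := {x | ∀ i, x i ∈ A i}
  obtain ⟨B, hB⟩ := hK.exists_bound_of_continuousOn (f := fun x => ∑ i, F x i ^ 2)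
    (continuousOn_finsetSum Finset.univ fun i _ => (hF i).pow 2)
  have hB' : ∀ x ∈ K, ∑ i, F x i ^ 2 ≤ |B| := fun x hx =>
    (le_abs_self _).trans ((hB x hx).trans (le_abs_self B))
  set η : ℝ := ε / (|B| + 1) with hη
  have hη0 : 0 < η := by positivity
  have hηB : η * |B| ≤ ε := by
    rw [hη, div_mul_eq_mul_div, div_le_iff₀ (by positivity)]
    nlinarith
  choose x₀ hx₀ using hne
  set x : ℕ → V → ℝ := fun k =>
    Nat.rec x₀ (fun _ u i => proj (A i) (u i - η * F u i)) k with hxdef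
  have hxs : ∀ k i, x (k + 1) i = proj (A i) (x k i - η * F (x k) i) := fun k i => rfl
  have hx : ∀ k, x k ∈ K := by
    intro k
    induction k with
    | zero => exact hx₀
    | succ k ih => exact fun i => by rw [hxs]; exact (proj_spec ⟨_, hx₀ i⟩ (hc i) _).1
  obtain ⟨D, hD⟩ := hK.exists_bound_of_continuousOn (f := fun y => ∑ i, (x₀ i - y i) ^ 2)
    (by fun_prop)
  -- Expand the square after each nonexpansive projection. Monotonicity replaces `F (x n)` by `F y`,
  -- which makes the bound affine in the iterates, so that it passes to their average.
  have key : ∀ y ∈ K, ∀ n : ℕ, 2 * η * ∑ k ∈ Finset.range n, ∑ i, F y i * (x k i - y i) +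
      ∑ i, (x n i - y i) ^ 2 ≤ ∑ i, (x₀ i - y i) ^ 2 + n * (η ^ 2 * |B|) := by
    intro y hy n
    induction n with
    | zero => simp [hxdef]
    | succ n ih =>
      have h1 : ∑ i, (x (n + 1) i - y i) ^ 2 ≤ ∑ i, ((x n i - y i) ^ 2 -
          2 * η * (F (x n) i * (x n i - y i)) + η ^ 2 * F (x n) i ^ 2) :=
        Finset.sum_le_sum fun i _ => by
          rw [hxs]
          refine (sq_proj_sub_le ⟨_, hx₀ i⟩ (hc i) (hconv i) _ (hy i)).trans (le_of_eq ?_)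
          ring
      rw [Finset.sum_add_distrib, Finset.sum_sub_distrib, ← Finset.mul_sum,
        ← Finset.mul_sum] at h1
      have h2 := hmono (x n) (hx n) y hy
      have h3 : ∑ i, (F (x n) i - F y i) * (x n i - y i) =
          ∑ i, F (x n) i * (x n i - y i) - ∑ i, F y i * (x n i - y i) := by
        rw [← Finset.sum_sub_distrib]
        exact Finset.sum_congr rfl fun i _ => by ring
      rw [h3] at h2
      have h4 := mul_le_mul_of_nonneg_left (hB' (x n) (hx n)) (sq_nonneg η)
      have h5 := mul_nonneg (by positivity : 0 ≤ 2 * η) h2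
      rw [Finset.sum_range_succ]
      push_cast
      linarith
  -- For such `n`, the initial distance is at most `n * η * ε`. The accumulated quadratic terms obey
  -- the same bound by the choice of `η`, and the sum is divided by `2 * η * n`.
  obtain ⟨n, hn⟩ := exists_nat_gt (|D| / (η * ε))
  have hn0 : (0 : ℝ) < n := lt_of_le_of_lt (by positivity) hn
  rw [div_lt_iff₀ (by positivity)] at hn
  refine ⟨fun i => ∑ k ∈ Finset.range n, (n : ℝ)⁻¹ * x k i, fun i => ?_, fun y hy => ?_⟩
  · refine (hconv i).sum_mem (fun _ _ => by positivity) ?_ fun k _ => hx k i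
    simp [hn0.ne']
  · have h1 := key y hy n
    have h2 : ∑ i, F y i * (∑ k ∈ Finset.range n, (n : ℝ)⁻¹ * x k i - y i) =
        (n : ℝ)⁻¹ * ∑ k ∈ Finset.range n, ∑ i, F y i * (x k i - y i) := by
      rw [Finset.sum_comm, Finset.mul_sum]
      refine Finset.sum_congr rfl fun i _ => ?_
      rw [← Finset.mul_sum, ← Finset.mul_sum, Finset.sum_sub_distrib]
      simp only [Finset.sum_const, Finset.card_range, nsmul_eq_mul]
      field_simp
    rw [h2, inv_mul_le_iff₀ hn0]
    have h3 : ∑ i, (x₀ i - y i) ^ 2 ≤ |D| :=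
      (le_abs_self _).trans ((hD y hy).trans (le_abs_self D))
    have h4 : 0 ≤ ∑ i, (x n i - y i) ^ 2 := Finset.sum_nonneg fun i _ => sq_nonneg _
    have h5 : η * (n * (η * |B|)) ≤ η * (n * ε) := by gcongr
    have h6 : 2 * η * ∑ k ∈ Finset.range n, ∑ i, F y i * (x k i - y i) ≤ 2 * η * (n * ε) := by
      nlinarith
    exact le_of_mul_le_mul_left h6 (by positivity)

/-- A monotone continuous mapping on a compact box has a solution of its variational
inequality. -/
theorem exists_variational_solution {V : Type*} [Fintype V] {A : V → Set ℝ}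
    (hne : ∀ i, (A i).Nonempty)
    (hc : ∀ i, IsCompact (A i)) (hconv : ∀ i, Convex ℝ (A i)) {F : (V → ℝ) → V → ℝ}
    (hF : ∀ i, ContinuousOn (fun x => F x i) {x | ∀ i, x i ∈ A i})
    (hmono : ∀ x : V → ℝ, (∀ i, x i ∈ A i) → ∀ y : V → ℝ, (∀ i, y i ∈ A i) →
      0 ≤ ∑ i, (F x i - F y i) * (x i - y i)) :
    ∃ z : V → ℝ, (∀ i, z i ∈ A i) ∧ ∀ y : V → ℝ, (∀ i, y i ∈ A i) → 0 ≤ ∑ i, F z i * (y i - z i) := by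
  choose u hu hu' using fun n : ℕ => exists_approx_minty hne hc hconv hF hmono
    (Nat.one_div_pos_of_nat (α := ℝ) (n := n))
  obtain ⟨z, hz, ψ, hψ, hlim⟩ := (isCompact_box hc).tendsto_subseq hu
  have hminty : ∀ y : V → ℝ, (∀ i, y i ∈ A i) → ∑ i, F y i * (z i - y i) ≤ 0 := by
    intro y hy
    refine le_of_tendsto_of_tendsto (f := fun n => ∑ i, F y i * (u (ψ n) i - y i))
      (tendsto_finsetSum _ fun i _ => ?_)
      ((tendsto_one_div_add_atTop_nhds_zero_nat (𝕜 := ℝ)).comp hψ.tendsto_atTop)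
      (Eventually.of_forall fun n => hu' (ψ n) y hy)
    exact ((tendsto_pi_nhds.1 hlim i).sub_const _).const_mul _
  refine ⟨z, hz, fun y hy => ?_⟩
  -- Minty's trick: test at `z + t (y - z)`, divide by `t`, and let `t → 0` using the continuity of
  -- `F`.
  set t : ℕ → ℝ := fun n => 1 / ((n : ℝ) + 1) with ht
  have ht0 : ∀ n, 0 < t n := fun n => by positivity
  have ht1 : ∀ n, t n ≤ 1 := fun n => by
    simp only [ht]
    rw [div_le_one (by positivity)]
    linarith [(Nat.cast_nonneg n : (0 : ℝ) ≤ n)]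
  set v : ℕ → V → ℝ := fun n i => z i + t n * (y i - z i) with hv
  have hvK : ∀ n i, v n i ∈ A i := fun n i => by
    have := (hconv i) (hz i) (hy i) (sub_nonneg.2 (ht1 n)) (ht0 n).le (by ring)
    simp only [smul_eq_mul] at this
    convert this using 1
    simp only [hv]; ring
  have htlim : Tendsto t atTop (𝓝 0) := tendsto_one_div_add_atTop_nhds_zero_nat
  have hvlim : Tendsto v atTop (𝓝[{x | ∀ i, x i ∈ A i}] z) := by
    refine tendsto_nhdsWithin_iff.2 ⟨tendsto_pi_nhds.2 fun i => ?_, Eventually.of_forall hvK⟩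
    simpa using (htlim.mul_const (y i - z i)).const_add (z i)
  have hlimF : Tendsto (fun n => ∑ i, F (v n) i * (y i - z i)) atTop
      (𝓝 (∑ i, F z i * (y i - z i))) :=
    tendsto_finsetSum _ fun i _ => ((hF i z hz).tendsto.comp hvlim).mul_const _
  refine ge_of_tendsto hlimF (Eventually.of_forall fun n => ?_)
  have h1 := hminty (v n) (hvK n)
  have h2 : ∑ i, F (v n) i * (z i - v n i) = -(t n * ∑ i, F (v n) i * (y i - z i)) := by
    rw [Finset.mul_sum, ← Finset.sum_neg_distrib]
    exact Finset.sum_congr rfl fun i _ => by simp only [hv]; ring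
  rw [h2] at h1
  exact nonneg_of_mul_nonneg_right (by linarith) (ht0 n)

/-! ### Nash equilibria as solutions of a variational inequality -/

namespace Game

variable {V : Type*} {G : SimpleGraph V} {Γ : Game G}

theorem restrict_mem_localActions {x : V → ℝ} (hx : x ∈ Γ.actions) (i : V) :
    (fun j : Nbhd G i => x j.1) ∈ Γ.localActions i := fun j => hx j.1

variable [DecidableEq V]

theorem update_mem_localActions {i : V} {y : Nbhd G i → ℝ} (hy : y ∈ Γ.localActions i) {t : ℝ}
    (ht : t ∈ Γ.act i) : Function.update y (own G i) t ∈ Γ.localActions i := by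
  intro j
  by_cases h : j = own G i
  · subst h; simpa using ht
  · simpa [Function.update_of_ne h] using hy j

/-- Convexity makes the first-order condition sufficient: the derivative at `x i` separates the
secant slopes to its left from those to its right. -/
theorem Regular.isMinOn_ownCost (hreg : Γ.Regular) {x : V → ℝ} (hx : x ∈ Γ.actions) {i : V}
    (h : ∀ t ∈ Γ.act i, 0 ≤ Γ.pseudoGrad x i * (t - x i)) {t : ℝ} (ht : t ∈ Γ.act i) :
    Γ.cost i (fun j => x j.1) ≤ Γ.ownCost i (fun j => x j.1) t := by
  obtain ⟨-, -, -, -, hy⟩ := hreg i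
  obtain ⟨hdiff, hconv⟩ := hy _ (restrict_mem_localActions hx i)
  have hd := hdiff.differentiableOn one_ne_zero
  have h0 : Γ.cost i (fun j => x j.1) = Γ.ownCost i (fun j => x j.1) (x i) := by
    simp [ownCost]
  rw [h0]
  have h1 := h t ht
  rw [pseudoGrad, partialGrad] at h1
  rcases lt_trichotomy t (x i) with hlt | rfl | hlt
  · have h2 := hconv.slope_le_derivWithin ht (hx i) hlt (hd _ (hx i))
    rw [slope_def_field, div_le_iff₀ (by linarith)] at h2
    simp only at h1
    linarith
  · exact le_rfl
  · have h2 := hconv.derivWithin_le_slope (hx i) ht hlt (hd _ (hx i))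
    rw [slope_def_field, le_div_iff₀ (by linarith)] at h2
    simp only at h1
    linarith

theorem Regular.variational_of_isNash (hreg : Γ.Regular) {x : V → ℝ} (hx : Γ.IsNash x) (i : V)
    {t : ℝ} (ht : t ∈ Γ.act i) : 0 ≤ Γ.pseudoGrad x i * (t - x i) := by
  obtain ⟨-, -, hconv, -, -⟩ := hreg i
  have hmin : IsMinOn (Γ.ownCost i (fun j => x j.1)) (Γ.act i) (x i) := by
    intro u hu
    have := hx.2 i u hu
    simpa [ownCost] using this
  have hcone : t - x i ∈ posTangentConeAt (Γ.act i) (x i) := by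
    refine mem_posTangentConeAt_of_segment_subset ?_
    rw [add_sub_cancel]
    exact hconv.segment_subset (hx.1 i) ht
  have h1 := hmin.localize.fderivWithin_nonneg hcone
  have h2 : fderivWithin ℝ (Γ.ownCost i (fun j => x j.1)) (Γ.act i) (x i) (t - x i) =
      Γ.pseudoGrad x i * (t - x i) := by
    rw [pseudoGrad, partialGrad, derivWithin, mul_comm, ← smul_eq_mul, ← map_smul, smul_eq_mul,
      mul_one]
  rwa [h2] at h1

theorem Regular.isCompact_localActions (hreg : Γ.Regular) (i : V) :
    IsCompact (Γ.localActions i) :=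
  isCompact_box (A := fun j : Nbhd G i => Γ.act j.1) fun j => (hreg j.1).2.1

theorem Regular.isCompact_actions (hreg : Γ.Regular) : IsCompact Γ.actions :=
  isCompact_box fun i => (hreg i).2.1

variable [Fintype V]

/-- The positivity that drives the Lyapunov descent: strict monotonicity compares `y` with `z`, and
the variational inequality at `z` has the favourable sign. -/
theorem pseudoGrad_mul_sub_pos (hreg : Γ.Regular) (hmono : Γ.StrictlyMonotone) {z : V → ℝ}
    (hz : Γ.IsNash z) {y : V → ℝ} (hy : y ∈ Γ.actions) (hne : y ≠ z) :
    0 < ∑ i, Γ.pseudoGrad y i * (y i - z i) := by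
  have h1 := hmono y hy z hz.1 hne
  have h2 : 0 ≤ ∑ i, Γ.pseudoGrad z i * (y i - z i) :=
    Finset.sum_nonneg fun i _ => hreg.variational_of_isNash hz i (hy i)
  have h3 : ∑ i, (Γ.pseudoGrad y i - Γ.pseudoGrad z i) * (y i - z i) =
      ∑ i, Γ.pseudoGrad y i * (y i - z i) - ∑ i, Γ.pseudoGrad z i * (y i - z i) := by
    rw [← Finset.sum_sub_distrib]
    exact Finset.sum_congr rfl fun i _ => by ring
  linarith

theorem isNash_unique (hreg : Γ.Regular) (hmono : Γ.StrictlyMonotone) {z y : V → ℝ}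
    (hz : Γ.IsNash z) (hy : Γ.IsNash y) : y = z := by
  by_contra hne
  have h1 := pseudoGrad_mul_sub_pos hreg hmono hz hy.1 hne
  have h2 : 0 ≤ ∑ i, Γ.pseudoGrad y i * (z i - y i) :=
    Finset.sum_nonneg fun i _ => hreg.variational_of_isNash hy i (hz.1 i)
  have h3 : ∑ i, Γ.pseudoGrad y i * (z i - y i) = -∑ i, Γ.pseudoGrad y i * (y i - z i) := by
    rw [← Finset.sum_neg_distrib]
    exact Finset.sum_congr rfl fun i _ => by ring
  linarith

variable [DecidableRel G.Adj]

/-- Move the neighbours first, with the uniform constant `L`, then the own action with the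
neighbours fixed at `y`. As `σ` depends on `y`, this yields joint continuity only, not a joint
Lipschitz bound. -/
theorem LipschitzGrad.continuousOn_partialGrad (hlip : Γ.LipschitzGrad) (i : V) :
    ContinuousOn (Γ.partialGrad i) (Γ.localActions i) := by
  intro y hy
  obtain ⟨hσ, L, hL, hLy⟩ := hlip i
  obtain ⟨σ, hσ0, hσy⟩ := hσ y hy
  have hb : Continuous fun z : Nbhd G i → ℝ =>
      L * Real.sqrt (∑ j, (z j - Function.update y (own G i) (z (own G i)) j) ^ 2) +
        σ * |z (own G i) - y (own G i)| := by
    have : ∀ j, Continuous fun z : Nbhd G i → ℝ =>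
        Function.update y (own G i) (z (own G i)) j := fun j =>
      (continuous_apply j).comp (Continuous.update continuous_const (own G i) (continuous_apply _))
    fun_prop
  rw [ContinuousWithinAt, tendsto_iff_dist_tendsto_zero]
  refine squeeze_zero' (Eventually.of_forall fun _ => dist_nonneg)
    (eventually_nhdsWithin_of_forall fun z hz => ?_) (tendsto_nhdsWithin_of_tendsto_nhds
      (by simpa using hb.tendsto y))
  rw [Real.dist_eq]
  have h1 := hLy z hz _ (update_mem_localActions hy (hz (own G i))) (by simp)
  have h2 := hσy _ (hz (own G i)) _ (hy (own G i))
  rw [Function.update_eq_self] at h2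
  exact (abs_sub_le _ _ _).trans (add_le_add h1 h2)

theorem LipschitzGrad.continuousOn_pseudoGrad (hlip : Γ.LipschitzGrad) (i : V) :
    ContinuousOn (fun x => Γ.pseudoGrad x i) Γ.actions :=
  (hlip.continuousOn_partialGrad i).comp (by fun_prop) fun _ hx => restrict_mem_localActions hx i

theorem exists_isNash (hreg : Γ.Regular) (hmono : Γ.StrictlyMonotone) (hlip : Γ.LipschitzGrad) :
    ∃ x, Γ.IsNash x := by
  obtain ⟨z, hz, hvi⟩ := exists_variational_solution (F := Γ.pseudoGrad) (fun i => (hreg i).1)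
    (fun i => (hreg i).2.1) (fun i => (hreg i).2.2.1) hlip.continuousOn_pseudoGrad
    fun x hx y hy => by
      by_cases h : x = y
      · simp [h]
      · exact (hmono x hx y hy h).le
  refine ⟨z, hz, fun i t ht => hreg.isMinOn_ownCost hz (fun s hs => ?_) ht⟩
  -- Varying a single coordinate splits the variational inequality into one for each player.
  have h1 := hvi (Function.update z i s) fun j => by
    by_cases h : j = i
    · subst h; simpa using hs
    · simpa [Function.update_of_ne h] using hz j
  rw [Finset.sum_eq_single i (fun j _ hj => by simp [Function.update_of_ne hj]) (by simp)] at h1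
  simpa using h1

end Game

/-! ### The communication graph and the spread of information -/

theorem communicationGraph_le {V : Type*} {GI GC : SimpleGraph V}
    (h : CommunicationGraph GI GC) : GC ≤ GI := by
  rcases h with ⟨_, _, _, h⟩ | ⟨_, h⟩
  · exact h
  · exact h.le

/-- Neighbours in the interference graph are joined in the communication graph by a path of
length at most two. -/
theorem communicationGraph_adj_or_exists {V : Type*} {GI GC : SimpleGraph V}
    (h : CommunicationGraph GI GC) {i l : V} (hil : GI.Adj i l) :
    GC.Adj i l ∨ ∃ j, GC.Adj i j ∧ GC.Adj j l := by
  classical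
  rcases h with ⟨Gm, ⟨_, hfree, hmax⟩, hle, _⟩ | ⟨_, h⟩
  · by_cases hm : Gm.Adj i l
    · exact Or.inl (hle hm)
    · right
      -- The triangle created by the missing edge must contain that edge, since `Gm` has no
      -- triangle; its third vertex is the midpoint of the path.
      have hc := hmax i l hil hm
      simp only [SimpleGraph.CliqueFree, not_forall, not_not] at hc hfree
      obtain ⟨s, hs⟩ := hc
      obtain ⟨a, b, c, hab, hac, hbc, rfl⟩ := SimpleGraph.is3Clique_iff.1 hs
      have hfree' : ¬ (Gm.Adj a b ∧ Gm.Adj a c ∧ Gm.Adj b c) := fun ⟨h1, h2, h3⟩ =>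
        hfree _ (SimpleGraph.is3Clique_iff.2 ⟨a, b, c, h1, h2, h3, rfl⟩)
      suffices ∃ j, Gm.Adj i j ∧ Gm.Adj j l by
        obtain ⟨j, h1, h2⟩ := this
        exact ⟨j, hle h1, hle h2⟩
      have n1 := hab.ne
      have n2 := hac.ne
      have n3 := hbc.ne
      simp only [SimpleGraph.sup_adj, SimpleGraph.edge_adj] at hab hac hbc
      have s1 := fun u v => Gm.adj_comm u v
      grind
  · exact Or.inl (h ▸ hil)

/-- `i` and `j` are the two members of the pair `p`. -/
def Meets {V : Type*} (p : V × V) (i j : V) : Prop := (i = p.1 ∧ j = p.2) ∨ (i = p.2 ∧ j = p.1)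

/-- The members of the closed neighbourhood of `l` to which, after `t` meetings as listed in `w`,
the action of `l` has been passed on. -/
def Informed {V : Type*} (G : SimpleGraph V) (w : ℕ → V × V) (l : V) : ℕ → V → Prop
  | 0, i => i = l
  | t + 1, i => Informed G w l t i ∨
      ∃ j, Informed G w l t j ∧ (l = j ∨ G.Adj j l) ∧ Meets (w t) i j

theorem Informed.mono {V : Type*} {G : SimpleGraph V} {w : ℕ → V × V} {l i : V} {s t : ℕ} (hst : s ≤ t)
    (h : Informed G w l s i) : Informed G w l t i := by
  induction t, hst using Nat.le_induction with
  | base => exact h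
  | succ t _ ih => exact Or.inl ih

theorem Informed.congr {V : Type*} {G : SimpleGraph V} {w w' : ℕ → V × V} {l : V} {t : ℕ} (hw : ∀ s < t, w s = w' s) {i : V}
    (h : Informed G w l t i) : Informed G w' l t i := by
  induction t generalizing i with
  | zero => exact h
  | succ t ih =>
    have hw' : ∀ s < t, w s = w' s := fun s hs => hw s (by omega)
    rcases h with h | ⟨j, hj, hl, hm⟩
    · exact Or.inl (ih hw' h)
    · exact Or.inr ⟨j, ih hw' hj, hl, hw t (by omega) ▸ hm⟩

/-- The word runs twice through all ordered pairs adjacent in `GC`. The first round informs the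
`GC`-neighbours of `l`, the second those reached through a midpoint `j`. The midpoint can relay
because `GC ≤ G` makes it a neighbour of `l`, so it holds an estimate of the action of `l`. -/
theorem exists_informing_word {V : Type*} [Fintype V] {G GC : SimpleGraph V} (hGC : CommunicationGraph G GC)
    {u v : V} (huv : GC.Adj u v) :
    ∃ (T : ℕ) (w : ℕ → V × V), 0 < T ∧ (∀ t, GC.Adj (w t).1 (w t).2) ∧
      ∀ i (l : Nbhd G i), Informed G w l.1 T i := by
  classical
  set E : Finset (V × V) := Finset.univ.filter fun q => GC.Adj q.1 q.2 with hE
  have hn : 0 < E.card := Finset.card_pos.2 ⟨(u, v), by simp [hE, huv]⟩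
  set w : ℕ → V × V := fun t => (E.equivFin.symm ⟨t % E.card, Nat.mod_lt _ hn⟩ : V × V) with hw
  have hwt : ∀ t, GC.Adj (w t).1 (w t).2 := fun t =>
    (Finset.mem_filter.1 (E.equivFin.symm ⟨t % E.card, Nat.mod_lt _ hn⟩).2).2
  have hcover : ∀ i j, GC.Adj i j → ∃ s < E.card, w s = (i, j) ∧ w (E.card + s) = (i, j) := by
    intro i j hij
    have hmem : (i, j) ∈ E := by simp [hE, hij]
    refine ⟨E.equivFin ⟨(i, j), hmem⟩, Fin.is_lt _, ?_, ?_⟩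
    · simp [hw, Nat.mod_eq_of_lt]
    · simp [hw, Nat.mod_eq_of_lt]
  have hone : ∀ i l, GC.Adj i l → Informed G w l E.card i := by
    intro i l hil
    obtain ⟨s, hs, hws, -⟩ := hcover i l hil
    refine Informed.mono (Nat.succ_le_of_lt hs) (Or.inr ⟨l, ?_, Or.inl rfl, ?_⟩)
    · exact Informed.mono (Nat.zero_le s) rfl
    · exact Or.inl (by simp [hws])
  refine ⟨2 * E.card, w, by omega, hwt, fun i l => ?_⟩
  rcases l with ⟨l, rfl | hil⟩
  · exact Informed.mono (Nat.zero_le _) rfl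
  · rcases communicationGraph_adj_or_exists hGC hil with h | ⟨j, hij, hjl⟩
    · exact (hone i l h).mono (by omega)
    · obtain ⟨s, hs, -, hws⟩ := hcover i j hij
      refine Informed.mono (s := E.card + s + 1) (by omega) (Or.inr ⟨j, ?_, ?_, ?_⟩)
      · exact (hone j l hjl).mono (by omega)
      · exact Or.inr (communicationGraph_le hGC hjl)
      · exact Or.inl (by simp [hws])

/-! ### Consensus of the estimates -/

section Algorithm

variable {V : Type*} [DecidableEq V] {G : SimpleGraph V} [DecidableRel G.Adj]

/-- The differences between the estimates and the actions. -/
def estError (e : Estimates G) : Estimates G := fun i l => e i l - e l.1 (own G l.1)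

theorem gossipStep_of_meets (e : Estimates G) {p : V × V} {i j : V} (hp : Meets p i j)
    {l : Nbhd G i} (hl : l.1 ≠ i) (h : l.1 = j ∨ G.Adj j l.1) :
    gossipStep e p i l = (e i l + e j ⟨l.1, h⟩) / 2 := by
  obtain ⟨a, b⟩ := p
  rcases hp with ⟨h1, h2⟩ | ⟨h1, h2⟩
  · dsimp only at h1 h2
    subst h1 h2
    simp [gossipStep, exchange, hl, h]
  · dsimp only at h1 h2
    subst h1 h2
    by_cases h2 : i = j
    · subst h2
      simp [gossipStep, exchange, hl]
    · simp [gossipStep, h2, exchange, hl, h]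

theorem gossipStep_cases (e : Estimates G) (p : V × V) (i : V) (l : Nbhd G i) :
    gossipStep e p i l = e i l ∨
      ∃ j, ∃ h : l.1 = j ∨ G.Adj j l.1, gossipStep e p i l = (e i l + e j ⟨l.1, h⟩) / 2 := by
  simp only [gossipStep]
  split_ifs
  · by_cases h : l.1 ≠ i ∧ (l.1 = p.2 ∨ G.Adj p.2 l.1)
    · exact Or.inr ⟨p.2, h.2, by simp only [exchange, dif_pos h]⟩
    · exact Or.inl (by simp only [exchange, dif_neg h])
  · by_cases h : l.1 ≠ i ∧ (l.1 = p.1 ∨ G.Adj p.1 l.1)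
    · exact Or.inr ⟨p.1, h.2, by simp only [exchange, dif_pos h]⟩
    · exact Or.inl (by simp only [exchange, dif_neg h])
  · exact Or.inl rfl

variable {Γ : Game G} {e₀ : Estimates G} {p : ℕ → V × V}

theorem algActions_succ (k : ℕ) (i : V) :
    algActions Γ e₀ p (k + 1) i =
      newAction Γ (tempEstimates Γ e₀ p k) (p k) (1 / (updateCount p k i : ℝ)) i := by
  simp [algActions, tempEstimates]

theorem updateCount_eq_count (k : ℕ) (i : V) :
    updateCount p k i = Nat.count (fun l => i = (p l).1 ∨ i = (p l).2) (k + 1) := by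
  rw [Nat.count_eq_card_filter_range, updateCount]

theorem estError_own (k : ℕ) {i : V} {l : Nbhd G i} (hl : l.1 = i) :
    estError (tempEstimates Γ e₀ p k) i l = 0 := by
  obtain ⟨l, hl'⟩ := l
  dsimp only at hl
  subst hl
  simp [estError]

theorem estError_succ (k : ℕ) {i : V} {l : Nbhd G i} (hl : l.1 ≠ i) :
    estError (tempEstimates Γ e₀ p (k + 1)) i l =
      (gossipStep (tempEstimates Γ e₀ p k) (p k) i l - algActions Γ e₀ p k l.1) -
        (algActions Γ e₀ p (k + 1) l.1 - algActions Γ e₀ p k l.1) := by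
  have h1 : tempEstimates Γ e₀ p (k + 1) i l =
      gossipStep (tempEstimates Γ e₀ p k) (p k) i l := by
    simp [tempEstimates, hl]
  simp only [estError, h1, algActions]
  ring

/-- After `t` iterations all errors are at most the initial bound, up to the displacement of the
actions, and the errors of informed players are smaller by a factor. -/
theorem abs_estError_le {M η : ℝ} (hM : 0 ≤ M) (hη : 0 ≤ η) {n : ℕ}
    (h0 : ∀ i l, |estError (tempEstimates Γ e₀ p n) i l| ≤ M)
    (hmove : ∀ k ≥ n, ∀ i, |algActions Γ e₀ p (k + 1) i - algActions Γ e₀ p k i| ≤ η) (t : ℕ) :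
    (∀ i l, |estError (tempEstimates Γ e₀ p (n + t)) i l| ≤ M + t * η) ∧
      ∀ i (l : Nbhd G i), Informed G (fun s => p (n + s)) l.1 t i →
        |estError (tempEstimates Γ e₀ p (n + t)) i l| ≤ (1 - (1 / 2) ^ t) * M + t * η := by
  induction t with
  | zero =>
    -- Initially only `l` is informed, and its own error is `0`, in accordance with `1 - (1/2)^0 =
    -- 0`.
    refine ⟨by simpa using h0, fun i l hl => ?_⟩
    rw [estError_own _ (Eq.symm hl)]
    simp
  | succ t ih =>
    obtain ⟨ih1, ih2⟩ := ih
    set e := tempEstimates Γ e₀ p (n + t) with he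
    have hpow : (0 : ℝ) < (1 / 2) ^ t := by positivity
    have hpow1 : ((1 : ℝ) / 2) ^ t ≤ 1 := pow_le_one₀ (by norm_num) (by norm_num)
    have hpM : ((1 : ℝ) / 2) ^ t * M ≤ M := mul_le_of_le_one_left hM hpow1
    have hpM0 : 0 ≤ ((1 : ℝ) / 2) ^ t * M := by positivity
    have htη : 0 ≤ t * η := by positivity
    -- The gossip bound refers to the old action of `l`; the move of `l` in the same iteration costs
    -- one more `η`. Own errors vanish.
    have hred : ∀ {i : V} {l : Nbhd G i} {c : ℝ}, 0 ≤ c + t * η →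
        (l.1 ≠ i → |gossipStep e (p (n + t)) i l - algActions Γ e₀ p (n + t) l.1| ≤ c + t * η) →
        |estError (tempEstimates Γ e₀ p (n + (t + 1))) i l| ≤ c + (t + 1 : ℕ) * η := by
      intro i l c hc h
      push_cast
      by_cases hl : l.1 = i
      · rw [estError_own _ hl, abs_zero]
        linarith
      · rw [← add_assoc, estError_succ _ hl]
        refine (abs_sub _ _).trans ?_
        have := h hl
        have := hmove (n + t) (by omega) l.1
        linarith
    have havg : ∀ {i j : V} {l : Nbhd G i} (h : l.1 = j ∨ G.Adj j l.1),
        (e i l + e j ⟨l.1, h⟩) / 2 - algActions Γ e₀ p (n + t) l.1 =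
          (estError e i l + estError e j ⟨l.1, h⟩) / 2 := by
      intro i j l h
      simp only [estError, algActions, he]
      ring
    have hkeep : ∀ i (l : Nbhd G i),
        e i l - algActions Γ e₀ p (n + t) l.1 = estError e i l := fun i l => rfl
    have havg_le : ∀ {a b A B : ℝ}, |a| ≤ A → |b| ≤ B → |(a + b) / 2| ≤ (A + B) / 2 := by
      intro a b A B ha hb
      rw [abs_div, abs_two]
      have := abs_add_le a b
      linarith
    refine ⟨fun i l => hred (by positivity) fun _ => ?_, fun i l hl => hred ?_ fun hli => ?_⟩
    · rcases gossipStep_cases e (p (n + t)) i l with h | ⟨j, hj, h⟩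
      · rw [h]
        exact ih1 i l
      · rw [h, havg]
        exact (havg_le (ih1 _ _) (ih1 _ _)).trans (by linarith)
    · rw [pow_succ]
      linarith
    · rw [pow_succ]
      -- Averaging an error of at most `(1 - (1/2)^t) * M` with one of at most `M` gives `(1 -
      -- (1/2)^(t+1)) * M`. Hence a newly informed player gains, and an informed one keeps enough
      -- whomever it meets.
      rcases hl with hl | ⟨j, hj, hjl, hm⟩
      · have h1 := ih2 i l hl
        rcases gossipStep_cases e (p (n + t)) i l with h | ⟨j, hj, h⟩
        · rw [h]
          refine h1.trans ?_
          linarith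
        · rw [h, havg]
          exact (havg_le h1 (ih1 _ _)).trans (by linarith)
      · rw [gossipStep_of_meets e hm hli hjl, havg]
        exact (havg_le (ih1 _ _) (ih2 _ ⟨l.1, hjl⟩ hj)).trans (by linarith)

variable [Fintype V]

theorem norm_estimates_le_iff {e : Estimates G} {c : ℝ} (hc : 0 ≤ c) :
    ‖e‖ ≤ c ↔ ∀ i l, |e i l| ≤ c := by
  rw [pi_norm_le_iff_of_nonneg hc]
  simp only [pi_norm_le_iff_of_nonneg hc, Real.norm_eq_abs]

theorem abs_apply_le_norm (e : Estimates G) (i : V) (l : Nbhd G i) : |e i l| ≤ ‖e‖ :=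
  (norm_estimates_le_iff (norm_nonneg e)).1 le_rfl i l

/-- The estimates approach the actions if a word that informs all players is met with positive
frequency and the actions move by `O(1 / k)`. -/
theorem tendsto_estError {C : ℝ} (hC : 0 < C)
    (hmove : ∀ k i, |algActions Γ e₀ p (k + 1) i - algActions Γ e₀ p k i| ≤ C / ((k : ℝ) + 1))
    {T : ℕ} (hT : 0 < T) {w : ℕ → V × V} (hw : ∀ i (l : Nbhd G i), Informed G w l.1 T i)
    {g : ℕ → Prop} [DecidablePred g] (hg : ∀ b, g b → ∀ t < T, p (b * T + t) = w t)
    {r : ℝ} (hr : 0 < r) (hN : Tendsto (fun b => (Nat.count g b : ℝ) / b) atTop (𝓝 r)) :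
    Tendsto (fun k => ‖estError (tempEstimates Γ e₀ p k)‖) atTop (𝓝 0) := by
  set M : ℕ → ℝ := fun k => ‖estError (tempEstimates Γ e₀ p k)‖ with hMdef
  have hM : ∀ k, 0 ≤ M k := fun k => norm_nonneg _
  have hmv : ∀ b : ℕ, ∀ k ≥ b * T, ∀ i,
      |algActions Γ e₀ p (k + 1) i - algActions Γ e₀ p k i| ≤ C / ((b : ℝ) + 1) := by
    intro b k hk i
    refine (hmove k i).trans ?_
    have : (b : ℝ) ≤ k := by exact_mod_cast (Nat.le_mul_of_pos_right b hT).trans hk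
    gcongr
  have hblock := fun b t => abs_estError_le (Γ := Γ) (e₀ := e₀) (p := p) (hM (b * T))
    (by positivity : 0 ≤ C / ((b : ℝ) + 1)) (abs_apply_le_norm _) (hmv b) t
  have hle : ∀ b t, M (b * T + t) ≤ M (b * T) + t * (C / ((b : ℝ) + 1)) := fun b t =>
    (norm_estimates_le_iff (add_nonneg (hM _) (by positivity))).2 (hblock b t).1
  have hTC : ∀ b : ℕ, (T : ℝ) * (C / ((b : ℝ) + 1)) = T * C / ((b : ℝ) + 1) :=
    fun b => by ring
  have hpow : ((1 : ℝ) / 2) ^ T ≤ 1 := pow_le_one₀ (by norm_num) (by norm_num)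
  -- At block boundaries the contraction lemma applies: a block that spells the word contracts by `1
  -- - (1/2)^T`, any block adds at most `T * C / (b + 1)`. The latter also bounds the growth inside
  -- a block.
  have hm : Tendsto (fun b => M (b * T)) atTop (𝓝 0) := by
    refine tendsto_zero_of_contraction (fun b => hM _) hr hN (C := T * C) (by positivity)
      (ρ := 1 - (1 / 2) ^ T) (sub_lt_self _ (by positivity)) (fun b => ?_) fun b hb => ?_
    · rw [Nat.succ_mul, ← hTC]
      exact hle b T
    · rw [Nat.succ_mul, ← hTC]
      refine (norm_estimates_le_iff ?_).2 fun i l => (hblock b T).2 i l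
        ((hw i l).congr fun t ht => (hg b hb t ht).symm)
      exact add_nonneg (mul_nonneg (by linarith) (hM _)) (by positivity)
  have hdiv : Tendsto (fun k => k / T) atTop atTop :=
    Nat.tendsto_div_const_atTop hT.ne'
  have hbound : Tendsto (fun b : ℕ => M (b * T) + T * C * (1 / ((b : ℝ) + 1))) atTop (𝓝 0) := by
    simpa using hm.add ((tendsto_one_div_add_atTop_nhds_zero_nat (𝕜 := ℝ)).const_mul (T * C))
  refine squeeze_zero hM (fun k => ?_) (hbound.comp hdiv)
  simp only [Function.comp_apply]
  have h1 := hle (k / T) (k % T)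
  rw [Nat.div_add_mod'] at h1
  refine h1.trans (add_le_add le_rfl ?_)
  rw [mul_one_div, ← hTC]
  have : ((k % T : ℕ) : ℝ) ≤ T := by exact_mod_cast (Nat.mod_lt k hT).le
  gcongr

end Algorithm

/-! ### Convergence along a typical sample path -/

section Convergence

variable {V : Type*} [DecidableEq V] {G : SimpleGraph V} [DecidableRel G.Adj]
  {Γ : Game G} {e₀ : Estimates G} {p : ℕ → V × V}

theorem gossipStep_mem (hreg : Γ.Regular) {e : Estimates G} (he : ∀ i, e i ∈ Γ.localActions i)
    (q : V × V) (i : V) : gossipStep e q i ∈ Γ.localActions i := by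
  intro l
  rcases gossipStep_cases e q i l with h | ⟨j, hj, h⟩
  · rw [h]; exact he i l
  · rw [h]
    have h1 := (hreg l.1).2.2.1 (he i l) (he j ⟨l.1, hj⟩) (by norm_num : (0 : ℝ) ≤ 1 / 2)
      (by norm_num : (0 : ℝ) ≤ 1 / 2) (by norm_num)
    simp only [smul_eq_mul] at h1
    convert h1 using 1
    ring

theorem newAction_mem (hreg : Γ.Regular) {e : Estimates G} (he : ∀ i, e i ∈ Γ.localActions i)
    (q : V × V) (a : ℝ) (i : V) : newAction Γ e q a i ∈ Γ.act i := by
  rw [newAction]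
  split_ifs
  · exact (proj_spec (hreg i).1 (hreg i).2.1 _).1
  · exact he i (own G i)

theorem tempEstimates_mem (hreg : Γ.Regular) (he₀ : ∀ i, e₀ i ∈ Γ.localActions i) (k : ℕ) (i : V) :
    tempEstimates Γ e₀ p k i ∈ Γ.localActions i := by
  induction k generalizing i with
  | zero => exact he₀ i
  | succ k ih =>
    intro l
    simp only [tempEstimates]
    split_ifs with h
    · rw [h]; exact newAction_mem hreg ih _ _ _
    · exact gossipStep_mem hreg ih _ _ _

theorem algActions_mem (hreg : Γ.Regular) (he₀ : ∀ i, e₀ i ∈ Γ.localActions i) (k : ℕ) :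
    algActions Γ e₀ p k ∈ Γ.actions := fun i => tempEstimates_mem hreg he₀ k i (own G i)

/-- The point at which player `i` evaluates the gradient. -/
noncomputable def gradPoint (e : Estimates G) (q : V × V) (i : V) : Nbhd G i → ℝ :=
  Function.update (gossipStep e q i) (own G i) (e i (own G i))

theorem gradPoint_mem (hreg : Γ.Regular) {e : Estimates G} (he : ∀ i, e i ∈ Γ.localActions i)
    (q : V × V) (i : V) : gradPoint e q i ∈ Γ.localActions i :=
  Game.update_mem_localActions (gossipStep_mem hreg he q i) (he i (own G i))

/-- Giving resting players the step size `b = 0` puts moving and resting players under one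
inequality. -/
theorem sq_newAction_sub_le (hreg : Γ.Regular) {e : Estimates G} {q : V × V} {a : ℝ} {i : V}
    {z : ℝ} (hz : z ∈ Γ.act i) {b : ℝ} (hb : b = if i = q.1 ∨ i = q.2 then a else 0) :
    (newAction Γ e q a i - z) ^ 2 ≤
      (e i (own G i) - b * Γ.partialGrad i (gradPoint e q i) - z) ^ 2 := by
  rw [newAction, hb]
  split_ifs
  · exact sq_proj_sub_le (hreg i).1 (hreg i).2.1 (hreg i).2.2.1 _ hz
  · simp

theorem abs_newAction_sub_le (hreg : Γ.Regular) {e : Estimates G}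
    (he : ∀ i, e i ∈ Γ.localActions i) {q : V × V} {a B : ℝ} {i : V}
    (hB : |Γ.partialGrad i (gradPoint e q i)| ≤ B) {b : ℝ} (hb0 : 0 ≤ b)
    (hb : b = if i = q.1 ∨ i = q.2 then a else 0) :
    |newAction Γ e q a i - e i (own G i)| ≤ b * B := by
  have h1 := sq_newAction_sub_le hreg (e := e) (he i (own G i)) hb
  rw [sq_le_sq] at h1
  refine h1.trans ?_
  rw [sub_right_comm, sub_self, zero_sub, abs_neg, abs_mul, abs_of_nonneg hb0]
  exact mul_le_mul_of_nonneg_left hB hb0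

variable [Fintype V]

theorem abs_gradPoint_sub_le (e : Estimates G) (q : V × V) (i : V) (j : Nbhd G i) :
    |gradPoint e q i j - e j.1 (own G j.1)| ≤ ‖estError e‖ := by
  by_cases hj : j = own G i
  · subst hj
    simp [gradPoint]
  · rw [gradPoint, Function.update_of_ne hj]
    rcases gossipStep_cases e q i j with h | ⟨l, hl, h⟩
    · rw [h]
      exact abs_apply_le_norm (estError e) i j
    · rw [h]
      have h1 := abs_apply_le_norm (estError e) i j
      have h2 := abs_apply_le_norm (estError e) l ⟨j.1, hl⟩
      have h3 : (e i j + e l ⟨j.1, hl⟩) / 2 - e j.1 (own G j.1) =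
          (estError e i j + estError e l ⟨j.1, hl⟩) / 2 := by
        simp only [estError]; ring
      rw [h3, abs_div, abs_two]
      have := abs_add_le (estError e i j) (estError e l ⟨j.1, hl⟩)
      linarith

theorem exists_lipschitz_const (hlip : Γ.LipschitzGrad) : ∃ L, 0 ≤ L ∧
    ∀ i, ∀ y ∈ Γ.localActions i, ∀ z ∈ Γ.localActions i, y (own G i) = z (own G i) →
      ∀ c, 0 ≤ c → (∀ j, |y j - z j| ≤ c) →
        |Γ.partialGrad i y - Γ.partialGrad i z| ≤ L * c := by
  choose L hL hLy using fun i => (hlip i).2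
  have hterm : ∀ i, 0 ≤ L i * Real.sqrt (Fintype.card (Nbhd G i)) := fun i =>
    mul_nonneg (hL i).le (Real.sqrt_nonneg _)
  refine ⟨∑ i, L i * Real.sqrt (Fintype.card (Nbhd G i)), Finset.sum_nonneg fun i _ => hterm i,
    fun i y hy z hz hyz c hc h => (hLy i y hy z hz hyz).trans ?_⟩
  have h1 : Real.sqrt (∑ j, (y j - z j) ^ 2) ≤ Real.sqrt (Fintype.card (Nbhd G i)) * c := by
    rw [← Real.sqrt_sq hc, ← Real.sqrt_mul (Nat.cast_nonneg _)]
    refine Real.sqrt_le_sqrt ?_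
    rw [← nsmul_eq_mul, Fintype.card]
    refine Finset.sum_le_card_nsmul _ _ _ fun j _ => ?_
    rw [← sq_abs]
    exact pow_le_pow_left₀ (abs_nonneg _) (h j) 2
  calc L i * Real.sqrt (∑ j, (y j - z j) ^ 2)
      ≤ L i * (Real.sqrt (Fintype.card (Nbhd G i)) * c) := mul_le_mul_of_nonneg_left h1 (hL i).le
    _ = L i * Real.sqrt (Fintype.card (Nbhd G i)) * c := by ring
    _ ≤ _ := mul_le_mul_of_nonneg_right (Finset.single_le_sum
        (f := fun i => L i * Real.sqrt (Fintype.card (Nbhd G i))) (fun i _ => hterm i)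
        (Finset.mem_univ i)) hc

theorem exists_grad_bound (hreg : Γ.Regular) (hlip : Γ.LipschitzGrad) :
    ∃ B, 0 < B ∧ ∀ i, ∀ y ∈ Γ.localActions i, |Γ.partialGrad i y| ≤ B := by
  choose B hB using fun i => (hreg.isCompact_localActions i).exists_bound_of_continuousOn
    (hlip.continuousOn_partialGrad i)
  refine ⟨∑ i, |B i| + 1, by positivity, fun i y hy => ?_⟩
  have h1 := Finset.single_le_sum (f := fun i => |B i|) (fun i _ => abs_nonneg _)
    (Finset.mem_univ i)
  have h2 := hB i y hy
  rw [Real.norm_eq_abs] at h2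
  have := le_abs_self (B i)
  linarith

/-- Convergence of the algorithm along a sequence of pairs in which every player has a positive
frequency and a word that informs all players is met with positive frequency. -/
theorem tendsto_algActions (hreg : Γ.Regular) (hmono : Γ.StrictlyMonotone)
    (hlip : Γ.LipschitzGrad) {z : V → ℝ} (hz : Γ.IsNash z)
    (he₀ : ∀ i, e₀ i ∈ Γ.localActions i)
    {T : ℕ} (hT : 0 < T) {w : ℕ → V × V} (hw : ∀ i (l : Nbhd G i), Informed G w l.1 T i)
    {g : ℕ → Prop} [DecidablePred g] (hg : ∀ b, g b → ∀ t < T, p (b * T + t) = w t)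
    {r : ℝ} (hr : 0 < r) (hN : Tendsto (fun b => (Nat.count g b : ℝ) / b) atTop (𝓝 r))
    {ρ : V → ℝ} (hρ : ∀ i, 0 < ρ i) (hfreq : ∀ i, Tendsto
      (fun b => (Nat.count (fun k => i = (p k).1 ∨ i = (p k).2) b : ℝ) / b) atTop (𝓝 (ρ i))) :
    Tendsto (fun k => algActions Γ e₀ p k) atTop (𝓝 z) := by
  obtain ⟨B, hB0, hB⟩ := exists_grad_bound hreg hlip
  obtain ⟨L, hL0, hL⟩ := exists_lipschitz_const hlip
  set a : V → ℕ → ℝ := fun i k => if i = (p k).1 ∨ i = (p k).2 then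
    1 / (Nat.count (fun k => i = (p k).1 ∨ i = (p k).2) (k + 1) : ℝ) else 0 with ha
  have ha0 : ∀ i k, 0 ≤ a i k := fun i k => by simp only [ha]; split_ifs <;> positivity
  choose c hc using fun i => exists_clock_le (hρ i) (hfreq i)
  replace hc : ∀ i k, a i k ≤ c i / ((k : ℝ) + 1) := hc
  have hc0 : ∀ i, 0 ≤ c i := fun i => by simpa using (ha0 i 0).trans (hc i 0)
  have hmem := fun k i => tempEstimates_mem (p := p) hreg he₀ k i
  have hstep : ∀ k i, a i k = if i = (p k).1 ∨ i = (p k).2 then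
      1 / (updateCount p k i : ℝ) else 0 := fun k i => by rw [updateCount_eq_count]
  have hmove : ∀ k i, |algActions Γ e₀ p (k + 1) i - algActions Γ e₀ p k i| ≤ a i k * B := by
    intro k i
    rw [algActions_succ]
    exact abs_newAction_sub_le hreg (hmem k) (hB i _ (gradPoint_mem hreg (hmem k) _ _)) (ha0 i k)
      (hstep k i)
  set C : ℝ := (∑ i, c i + 1) * B with hC
  have hsum0 : 0 ≤ ∑ i, c i := Finset.sum_nonneg fun i _ => hc0 i
  have hCpos : 0 < C := by positivity
  have hmove' : ∀ k i,
      |algActions Γ e₀ p (k + 1) i - algActions Γ e₀ p k i| ≤ C / ((k : ℝ) + 1) := by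
    intro k i
    refine (hmove k i).trans ?_
    have h1 := Finset.single_le_sum (f := c) (fun i _ => hc0 i) (Finset.mem_univ i)
    calc a i k * B ≤ c i / ((k : ℝ) + 1) * B := by gcongr; exact hc i k
      _ = c i * B / ((k : ℝ) + 1) := by ring
      _ ≤ C / ((k : ℝ) + 1) := by rw [hC]; gcongr; linarith
  have herr := tendsto_estError hCpos hmove' hT hw hg hr hN
  set m : ℕ → ℝ := fun k => ‖estError (tempEstimates Γ e₀ p k)‖ with hm
  obtain ⟨D, hD⟩ := hreg.isCompact_actions.exists_bound_of_continuousOn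
    (f := fun x => x - z) (by fun_prop)
  have hD' : ∀ k i, |algActions Γ e₀ p k i - z i| ≤ D := fun k i =>
    (norm_le_pi_norm (algActions Γ e₀ p k - z) i).trans (hD _ (algActions_mem hreg he₀ k))
  refine tendsto_of_lyapunov hreg.isCompact_actions (algActions_mem hreg he₀)
    (h := fun i x => Γ.pseudoGrad x i * (x i - z i))
    (fun i => (hlip.continuousOn_pseudoGrad i).mul (by fun_prop))
    (fun y hy hne => Game.pseudoGrad_mul_sub_pos hreg hmono hz hy hne) hρ hfreq hCpos.le hmove'
    -- Two errors, each with a factor `c i / (k + 1)` from the step size: the gradient is taken at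
    -- the estimates instead of the actions, which costs `L * m k`, and the square of the gradient
    -- step leaves a term of order `1 / (k + 1)`.
    (e := fun k => ∑ i, c i * (2 * (L * m k) * D + c i * B ^ 2 * (1 / ((k : ℝ) + 1)))) ?_
    fun k => ?_
  · have h1 : ∀ i, Tendsto (fun k : ℕ => c i * (2 * (L * m k) * D +
        c i * B ^ 2 * (1 / ((k : ℝ) + 1)))) atTop
        (𝓝 (c i * (2 * (L * 0) * D + c i * B ^ 2 * 0))) := fun i =>
      ((((herr.const_mul L).const_mul 2).mul_const D).add
        ((tendsto_one_div_add_atTop_nhds_zero_nat (𝕜 := ℝ)).const_mul _)).const_mul _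
    have h2 := tendsto_finsetSum Finset.univ fun i _ => h1 i
    simpa using h2
  · have h1 : ∀ i, (algActions Γ e₀ p (k + 1) i - z i) ^ 2 ≤ (algActions Γ e₀ p k i - z i) ^ 2 -
        2 * (a i k * (Γ.pseudoGrad (algActions Γ e₀ p k) i * (algActions Γ e₀ p k i - z i))) +
        c i * (2 * (L * m k) * D + c i * B ^ 2 * (1 / ((k : ℝ) + 1))) / ((k : ℝ) + 1) := by
      intro i
      have e1 := sq_newAction_sub_le hreg (e := tempEstimates Γ e₀ p k) (hz.1 i) (hstep k i)
      rw [← algActions_succ] at e1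
      have hgm := gradPoint_mem hreg (hmem k) (p k) i
      -- The two points share the own coordinate, so the uniform Lipschitz bound in the neighbours'
      -- actions suffices.
      have e2 := hL i _ hgm _ (Game.restrict_mem_localActions (algActions_mem hreg he₀ k) i)
        (by simp [gradPoint, algActions]) (m k) (norm_nonneg _)
        (fun j => abs_gradPoint_sub_le _ _ _ _)
      have e3 := hB i _ hgm
      set γ := Γ.partialGrad i (gradPoint (tempEstimates Γ e₀ p k) (p k) i)
      change |γ - Γ.pseudoGrad (algActions Γ e₀ p k) i| ≤ L * m k at e2
      set F := Γ.pseudoGrad (algActions Γ e₀ p k) i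
      change _ ≤ (algActions Γ e₀ p k i - a i k * γ - z i) ^ 2 at e1
      set u := algActions Γ e₀ p k i
      have e4 : -((γ - F) * (u - z i)) ≤ L * m k * D := by
        refine (neg_le_abs _).trans ?_
        rw [abs_mul]
        exact mul_le_mul e2 (hD' k i) (abs_nonneg _) ((abs_nonneg _).trans e2)
      have e5 : γ ^ 2 ≤ B ^ 2 := by
        rw [← sq_abs]
        exact pow_le_pow_left₀ (abs_nonneg _) e3 2
      have e6 : (u - a i k * γ - z i) ^ 2 = (u - z i) ^ 2 - 2 * (a i k * (F * (u - z i))) +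
          a i k * (2 * -((γ - F) * (u - z i)) + a i k * γ ^ 2) := by ring
      rw [e6] at e1
      refine e1.trans (add_le_add le_rfl ?_)
      have hLm : 0 ≤ L * m k := (abs_nonneg _).trans e2
      have hD0 : 0 ≤ D := (abs_nonneg _).trans (hD' k i)
      have e7 : a i k * γ ^ 2 ≤ c i * B ^ 2 * (1 / ((k : ℝ) + 1)) := by
        calc a i k * γ ^ 2 ≤ c i / ((k : ℝ) + 1) * B ^ 2 :=
              mul_le_mul (hc i k) e5 (sq_nonneg _) (div_nonneg (hc0 i) (by positivity))
          _ = _ := by ring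
      have := hc0 i
      calc a i k * (2 * -((γ - F) * (u - z i)) + a i k * γ ^ 2)
          ≤ a i k * (2 * (L * m k) * D + c i * B ^ 2 * (1 / ((k : ℝ) + 1))) :=
            mul_le_mul_of_nonneg_left (by linarith) (ha0 i k)
        _ ≤ c i / ((k : ℝ) + 1) * (2 * (L * m k) * D + c i * B ^ 2 * (1 / ((k : ℝ) + 1))) :=
            mul_le_mul_of_nonneg_right (hc i k) (by positivity)
        _ = _ := by ring
    have h2 := Finset.sum_le_sum fun i (_ : i ∈ Finset.univ) => h1 i
    rw [Finset.sum_add_distrib, Finset.sum_sub_distrib, ← Finset.mul_sum, ← Finset.sum_div] at h2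
    exact h2

end Convergence

/-! ### Frequencies of independent events and of gossip pairs -/

theorem indepFun_indicator_one {S : Type*} [MeasurableSpace S] {μ : Measure S} {A B : Set S}
    (h : IndepSet A B μ) :
    IndepFun (A.indicator fun _ => (1 : ℝ)) (B.indicator fun _ => (1 : ℝ)) μ := by
  have hle : ∀ D : Set S, MeasurableSpace.comap (D.indicator fun _ => (1 : ℝ)) inferInstance ≤
      MeasurableSpace.generateFrom {D} := fun D =>
    Measurable.comap_le (Measurable.indicator (@measurable_const _ _ _ (_) _)
      (MeasurableSpace.measurableSet_generateFrom (Set.mem_singleton D)))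
  rw [IndepSet_iff_Indep] at h
  rw [IndepFun_iff_Indep]
  exact indep_of_indep_of_le_left (indep_of_indep_of_le_right h (hle B)) (hle A)

theorem identDistrib_indicator_one {S : Type*} [MeasurableSpace S] {μ : Measure S}
    [IsProbabilityMeasure μ] {A B : Set S} (hA : MeasurableSet A) (hB : MeasurableSet B)
    (h : μ A = μ B) :
    IdentDistrib (A.indicator fun _ => (1 : ℝ)) (B.indicator fun _ => (1 : ℝ)) μ μ where
  aemeasurable_fst := (measurable_const.indicator hA).aemeasurable
  aemeasurable_snd := (measurable_const.indicator hB).aemeasurable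
  map_eq := by
    classical
    ext t ht
    rw [Measure.map_apply (measurable_const.indicator hA) ht,
      Measure.map_apply (measurable_const.indicator hB) ht,
      Set.indicator_const_preimage_eq_union, Set.indicator_const_preimage_eq_union]
    split_ifs <;> simp [h, prob_compl_eq_one_sub hA, prob_compl_eq_one_sub hB]

open Classical in
/-- The strong law of large numbers for pairwise independent events of the same probability. -/
theorem ae_tendsto_count {S : Type*} [MeasurableSpace S] {μ : Measure S}
    [IsProbabilityMeasure μ] {A : ℕ → Set S} (hA : ∀ n, MeasurableSet (A n)) {c : ℝ}
    (hc : ∀ n, μ.real (A n) = c)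
    (hind : ∀ a b, a < b → μ.real (A a ∩ A b) = μ.real (A a) * μ.real (A b)) :
    ∀ᵐ s ∂μ, Tendsto (fun n : ℕ => (Nat.count (fun b => s ∈ A b) n : ℝ) / n) atTop (𝓝 c) := by
  have hset : ∀ a b, a < b → IndepSet (A a) (A b) μ := fun a b hab => by
    refine (indepSet_iff_measure_inter_eq_mul (hA a) (hA b) μ).2 ?_
    have := hind a b hab
    rwa [measureReal_def, measureReal_def, measureReal_def, ← ENNReal.toReal_mul,
      ENNReal.toReal_eq_toReal_iff' (measure_ne_top _ _)
        (ENNReal.mul_ne_top (measure_ne_top _ _) (measure_ne_top _ _))] at this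
  have hlaw := strong_law_ae_real (μ := μ) (fun n => (A n).indicator fun _ => (1 : ℝ))
    ((integrable_const 1).indicator (hA 0)) (fun a b hab => ?_)
    (fun n => identDistrib_indicator_one (hA n) (hA 0) ?_)
  · filter_upwards [hlaw] with s hs
    have h1 : ∫ s, (A 0).indicator (fun _ => (1 : ℝ)) s ∂μ = c := by
      rw [integral_indicator_const _ (hA 0), hc, smul_eq_mul, mul_one]
    rw [h1] at hs
    refine hs.congr fun n => ?_
    rw [Nat.count_eq_card_filter_range, Finset.card_filter]
    simp [Set.indicator_apply]
  · rcases lt_or_gt_of_ne hab with h | h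
    · exact indepFun_indicator_one (hset a b h)
    · exact (indepFun_indicator_one (hset b a h)).symm
  · rw [← ENNReal.toReal_eq_toReal_iff' (measure_ne_top _ _) (measure_ne_top _ _)]
    exact (hc n).trans (hc 0).symm

section GossipPairs

variable {S V : Type*} [MeasurableSpace V] {G : SimpleGraph V}

theorem measurableSet_history {e₀ : S → Estimates G} {p : ℕ → S → V × V} {l k : ℕ} (h : l < k)
    {D : Set (V × V)} (hD : MeasurableSet D) : MeasurableSet[history e₀ p k] (p l ⁻¹' D) := by
  have h1 : MeasurableSpace.comap (p l) inferInstance ≤ history e₀ p k :=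
    (le_iSup (fun l : Fin k => MeasurableSpace.comap (p l) inferInstance) ⟨l, h⟩).trans
      le_sup_right
  exact h1 _ ⟨D, hD, rfl⟩

theorem history_mono {e₀ : S → Estimates G} {p : ℕ → S → V × V} {l k : ℕ} (h : l ≤ k) :
    history e₀ p l ≤ history e₀ p k :=
  sup_le le_sup_left <| iSup_le fun m => le_trans
    (le_iSup (fun l : Fin k => MeasurableSpace.comap (p l) inferInstance) ⟨m, m.2.trans_le h⟩)
    le_sup_right

theorem measurableSet_word [MeasurableSingletonClass V] {e₀ : S → Estimates G} {p : ℕ → S → V × V} {n k T : ℕ} (h : n + T ≤ k)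
    (w : ℕ → V × V) : MeasurableSet[history e₀ p k] {s | ∀ t < T, p (n + t) s = w t} := by
  have : {s | ∀ t < T, p (n + t) s = w t} = ⋂ t ∈ Finset.range T, p (n + t) ⁻¹' {w t} := by
    ext s; simp
  rw [this]
  refine Finset.measurableSet_biInter _ fun t ht => ?_
  rw [Finset.mem_range] at ht
  exact measurableSet_history (by omega) (MeasurableSet.singleton _)

variable {Γ : Game G} {GC : SimpleGraph V} {q : V → V → ℝ} {e₀ : S → Estimates G}
  {p : ℕ → S → V × V} [MeasurableSpace S] {μ : Measure S}

theorem IsGossipProcess.measureReal_inter (hp : IsGossipProcess Γ GC q e₀ p μ) {k : ℕ}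
    {H : Set S} (hH : MeasurableSet[history e₀ p k] H) {D : Set (V × V)} (hD : MeasurableSet D) :
    μ.real (H ∩ p k ⁻¹' D) = μ.real H * μ.real (p k ⁻¹' D) := by
  have := (Indep_iff _ _ _).1 (hp.indep k) _ _ ⟨D, hD, rfl⟩ hH
  rw [Set.inter_comm, measureReal_def, this, ENNReal.toReal_mul, mul_comm]
  rfl

theorem IsGossipProcess.history_le (hp : IsGossipProcess Γ GC q e₀ p μ) (k : ℕ) :
    history e₀ p k ≤ ‹MeasurableSpace S› :=
  sup_le hp.measurable_init.comap_le (iSup_le fun l => (hp.measurable_pair l).comap_le)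

variable [MeasurableSingletonClass V]

/-- Peel off the last letter: it is independent of the history, which contains `H` and the earlier
letters. With `H` the whole space this is the law of a word; with `H` an earlier block it is the
independence of blocks. -/
theorem IsGossipProcess.measureReal_inter_word (hp : IsGossipProcess Γ GC q e₀ p μ) {n : ℕ}
    {H : Set S} (hH : MeasurableSet[history e₀ p n] H) (w : ℕ → V × V) (T : ℕ) :
    μ.real (H ∩ {s | ∀ t < T, p (n + t) s = w t}) =
      μ.real H * ∏ t ∈ Finset.range T, q (w t).1 (w t).2 := by
  induction T with
  | zero => simp
  | succ T ih =>
    have h1 : H ∩ {s | ∀ t < T + 1, p (n + t) s = w t} =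
        (H ∩ {s | ∀ t < T, p (n + t) s = w t}) ∩ p (n + T) ⁻¹' {w T} := by
      ext s
      simp only [Set.mem_inter_iff, Set.mem_ofPred_eq, Set.mem_preimage, Set.mem_singleton_iff,
        Nat.forall_lt_succ_right, and_assoc]
    rw [h1, hp.measureReal_inter (MeasurableSet.inter (history_mono (Nat.le_add_right n T) _ hH)
      (measurableSet_word le_rfl w)) (MeasurableSet.singleton _), ih, Finset.prod_range_succ,
      mul_assoc]
    congr 2
    exact hp.law (n + T) (w T).1 (w T).2

open Classical in
/-- Almost surely, the frequency of a word among the blocks of its length is its probability. -/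
theorem IsGossipProcess.ae_tendsto_count_word [IsProbabilityMeasure μ]
    (hp : IsGossipProcess Γ GC q e₀ p μ) (w : ℕ → V × V) (T : ℕ) :
    ∀ᵐ s ∂μ, Tendsto
      (fun n : ℕ => (Nat.count (fun b => ∀ t < T, p (b * T + t) s = w t) n : ℝ) / n) atTop
      (𝓝 (∏ t ∈ Finset.range T, q (w t).1 (w t).2)) := by
  have hprob : ∀ n, μ.real {s | ∀ t < T, p (n + t) s = w t} =
      ∏ t ∈ Finset.range T, q (w t).1 (w t).2 := fun n => by
    have := hp.measureReal_inter_word (n := n) (H := Set.univ) MeasurableSet.univ w T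
    simpa using this
  have hlaw := ae_tendsto_count (A := fun b => {s | ∀ t < T, p (b * T + t) s = w t})
    (fun b => hp.history_le _ _ (measurableSet_word le_rfl w)) (fun b => hprob _)
    fun a b hab => by
      -- For `a < b`, block `a` ends at `(a + 1) * T ≤ b * T`, so it belongs to the history before
      -- block `b`.
      rw [hp.measureReal_inter_word, hprob (b * T)]
      exact measurableSet_word (by nlinarith) w
  filter_upwards [hlaw] with s hs
  convert hs

open Classical in
/-- Almost surely, the frequency of each player is positive. -/
theorem IsGossipProcess.ae_tendsto_count_player [Fintype V] [IsProbabilityMeasure μ]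
    (hp : IsGossipProcess Γ GC q e₀ p μ) {i j : V} (hij : GC.Adj i j) :
    ∃ r > 0, ∀ᵐ s ∂μ, Tendsto
      (fun n : ℕ => (Nat.count (fun k => i = (p k s).1 ∨ i = (p k s).2) n : ℝ) / n) atTop
      (𝓝 r) := by
  set D : Finset (V × V) := Finset.univ.filter fun x => i = x.1 ∨ i = x.2 with hD
  have hprob : ∀ k, μ.real (p k ⁻¹' D) = ∑ x ∈ D, q x.1 x.2 := fun k => by
    rw [← sum_measureReal_preimage_singleton D fun x _ =>
      hp.measurable_pair k (MeasurableSet.singleton x)]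
    exact Finset.sum_congr rfl fun x _ => hp.law k x.1 x.2
  have hq0 : ∀ u v, 0 ≤ q u v := fun u v => hp.law 0 u v ▸ measureReal_nonneg
  refine ⟨∑ x ∈ D, q x.1 x.2, ?_, ?_⟩
  · exact Finset.sum_pos' (fun x _ => hq0 _ _)
      ⟨(i, j), by simp [hD], (hp.support i j).2 hij⟩
  · have hDm : MeasurableSet (D : Set (V × V)) := D.measurableSet
    have := ae_tendsto_count (A := fun k => p k ⁻¹' D)
      (fun k => hp.measurable_pair k hDm) hprob
      fun a b hab => hp.measureReal_inter (measurableSet_history hab hDm) hDm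
    simpa [hD] using this

/-- The values of `q` sum to one, so they cannot all be nonpositive. The resulting edge also
supplies two distinct players. -/
theorem IsGossipProcess.exists_adj [Fintype V] [IsProbabilityMeasure μ]
    (hp : IsGossipProcess Γ GC q e₀ p μ) : ∃ u v, GC.Adj u v := by
  by_contra! hcon
  have h1 : μ.real (p 0 ⁻¹' (Finset.univ : Finset (V × V))) = ∑ x : V × V, q x.1 x.2 := by
    rw [← sum_measureReal_preimage_singleton _ fun x _ =>
      hp.measurable_pair 0 (MeasurableSet.singleton x)]
    exact Finset.sum_congr rfl fun x _ => hp.law 0 x.1 x.2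
  have h2 : ∑ x : V × V, q x.1 x.2 ≤ 0 := Finset.sum_nonpos fun x _ =>
    not_lt.1 fun h => hcon _ _ ((hp.support _ _).1 h)
  simp at h1
  linarith

end GossipPairs

end GossipNash

/-! ### The main theorem -/

theorem theorem2 {V S : Type*} [Fintype V] [DecidableEq V]
    [MeasurableSpace V] [MeasurableSingletonClass V]
    (GI GC : SimpleGraph V) [DecidableRel GI.Adj]
    (hGI : GI.Connected) (hGC : GossipNash.CommunicationGraph GI GC)
    (Γ : GossipNash.Game GI) (hreg : Γ.Regular) (hmono : Γ.StrictlyMonotone)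
    (hlip : Γ.LipschitzGrad)
    [MeasurableSpace S] (μ : Measure S) [IsProbabilityMeasure μ]
    (q : V → V → ℝ) (e₀ : S → GossipNash.Estimates GI) (p : ℕ → S → V × V)
    (hp : GossipNash.IsGossipProcess Γ GC q e₀ p μ) :
    ∃ xstar : V → ℝ, Γ.IsNash xstar ∧ (∀ y, Γ.IsNash y → y = xstar) ∧
      ∀ᵐ s ∂μ, Tendsto
        (fun k => GossipNash.algActions Γ (e₀ s) (fun l => p l s) k) atTop (𝓝 xstar) := by
  classical
  obtain ⟨z, hz⟩ := GossipNash.Game.exists_isNash hreg hmono hlip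
  refine ⟨z, hz, fun y hy => GossipNash.Game.isNash_unique hreg hmono hz hy, ?_⟩
  obtain ⟨u, v, huv⟩ := hp.exists_adj
  have : Nontrivial V := ⟨u, v, huv.ne⟩
  obtain ⟨T, w, hT, hw, hinf⟩ := GossipNash.exists_informing_word hGC huv
  -- Connectedness gives each player an interference neighbour, and the first edge of a
  -- communication path to it gives a communication neighbour; hence each player has positive
  -- frequency.
  have hadj : ∀ i, ∃ j, GC.Adj i j := fun i => by
    obtain ⟨l, hl⟩ := hGI.preconnected.exists_adj_of_nontrivial i
    rcases GossipNash.communicationGraph_adj_or_exists hGC hl with h | ⟨j, h, -⟩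
    · exact ⟨l, h⟩
    · exact ⟨j, h⟩
  choose j hj using hadj
  choose r hr hfreq using fun i => hp.ae_tendsto_count_player (hj i)
  filter_upwards [hp.ae_tendsto_count_word w T, ae_all_iff.2 hfreq] with s hs hs'
  have hpos : 0 < ∏ t ∈ Finset.range T, q (w t).1 (w t).2 :=
    Finset.prod_pos fun t _ => (hp.support _ _).2 (hw t)
  refine GossipNash.tendsto_algActions hreg hmono hlip hz (hp.init_mem s) hT hinf
    (g := fun b => ∀ t < T, p (b * T + t) s = w t) (fun b hb => hb) hpos ?_ hr fun i => ?_
  · convert hs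
  · convert hs' i
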